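/- **Setting.** Let $S_0,K,\sigma,\nu>0$, $r\in\mathbb R$, $\tfrac{\sigma^2\nu}{2}<1$ and $0\le t<T$, and put $\tau:=T-t$. On a filtered probability space $(\Omega,(\mathcal F_u)_{u\ge0},\mathbb Q)$ let $X$ be a symmetric Variance Gamma process, i.e. an $(\mathcal F_u)$-Lévy process with $X_0=0$ whose increment over a time $h>0$ has the density $$f_{\sigma,\nu}(x,h)=\int_0^\infty \frac{e^{-x^2/(2\sigma^2y)}}{\sigma\sqrt{2\pi y}}\;\frac{y^{h/\nu-1}e^{-y/\nu}}{\nu^{h/\nu}\,\Gamma(h/\nu)}\,dy .$$ Let $\omega_{\sigma,\nu}:=\frac1\nu\log\bigl(1-\frac{\sigma^2\nu}{2}\bigr)$ and $S_u:=S_0e^{(r+\omega_{\sigma,\nu})u+X_u}$. The value at time $t$ of the asset-or-nothing call with strike $K$ and maturity $T$ is $C:=\mathbb E^{\mathbb Q}\bigl[e^{-r\tau}S_T\mathbf 1_{\{S_T>K\}}\mid\mathcal F_t\bigr]$. Write $S:=S_t$ and $$F:=Ke^{-r\tau},\qquad \sigma_\nu:=\sigma\sqrt{\nu/2},\qquad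 k:=\log\frac SF+\omega_{\sigma,\nu}\tau,\qquad \alpha:=\frac\tau\nu-\frac12,$$ and assume $\alpha\notin\mathbb Z$. For $k\in\mathbb R$ and $s\ne0$ with $-k/s\ge 0$ define $$C^-(k,s):=\frac{F}{2\Gamma(\frac\tau\nu)}\sum_{n_1,n_2=0}^\infty\frac{(-1)^{n_1}}{n_1!}\left[\frac{\Gamma(\frac{-n_1+n_2+1}{2}+\alpha)}{\Gamma(\frac{-n_1+n_2}{2}+1)}\Bigl(\frac{-k}{s}\Bigr)^{n_1}s^{n_2}+2\,\frac{\Gamma(-2n_1-n_2-1-2\alpha)}{\Gamma(-n_1+\frac12-\alpha)}\Bigl(\frac{-k}{s}\Bigr)^{2n_1+1+2\alpha}(-k)^{n_2}\right],$$ where the quotients of Gamma functions are read by continuity in $\alpha$ (this matters only if $\alpha\in\frac12+\mathbb Z$), and $0^0:=1$. **Theorem (asset-or-nothing call in the symmetric Variance Gamma model).** The payoff $S_T\mathbf 1_{\{S_T>K\}}$ is integrable and, almost surely, all of the following series converge absolutely and: (i) (OTM price) if $k<0$, then $C=C^-(k,\sigma_\nu)$; (ii) (ITM price) if $k>0$,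 then $C=S-C^-(k,-\sigma_\nu)$; (iii) (ATM price) if $k=0$, then $$C=C^-(0,\sigma_\nu)=S-C^-(0,-\sigma_\nu)=\frac{F}{2\Gamma(\frac\tau\nu)}\sum_{n=0}^\infty\frac{\Gamma(\frac{n+1}{2}+\alpha)}{\Gamma(\frac n2+1)}\,\sigma_\nu^{\,n}.$$ -/

import Mathlib

open MeasureTheory ProbabilityTheory Filter Topology
open scoped NNReal ENNReal Nat

noncomputable section

namespace VarianceGamma

/-- The variance gamma density `f_{σ,ν,θ}(x,t)`: the normal density with mean `θ y` and variance
`σ² y`, integrated against the density in `y` of the Gamma law with mean `t` and variance `ν t`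
(shape `t/ν`, rate `1/ν`), i.e.
`∫₀^∞ (σ√(2πy))⁻¹ exp(-(x-θy)²/(2σ²y)) · y^{t/ν-1} e^{-y/ν} / (ν^{t/ν} Γ(t/ν)) dy`. -/
def vgDensity (σ ν θ t x : ℝ) : ℝ≥0∞ :=
  ∫⁻ y in Set.Ioi (0 : ℝ),
    gaussianPDF (θ * y) (Real.toNNReal (σ ^ 2 * y)) x * gammaPDF (t / ν) (1 / ν) y

/-- The law of a variance gamma process after a time `t > 0`. -/
def vgMeasure (σ ν θ t : ℝ) : Measure ℝ :=
  volume.withDensity (vgDensity σ ν θ t)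

/-- `X` is a variance gamma process on the filtered probability space `(Ω, ℱ, Q)`: a Lévy process
(adapted, started at `0`, with càdlàg paths, with increments that are independent of the past and
stationary) whose increments over a time `h > 0` have the variance gamma law. -/
structure IsVarianceGammaProcess {Ω : Type*} {mΩ : MeasurableSpace Ω} (Q : Measure Ω)
    (ℱ : Filtration ℝ≥0 mΩ) (X : ℝ≥0 → Ω → ℝ) (σ ν θ : ℝ) : Prop where
  adapted : StronglyAdapted ℱ X
  zero : ∀ᵐ w ∂Q, X 0 w = 0
  cadlag : ∀ᵐ w ∂Q, ∀ s : ℝ≥0, ContinuousWithinAt (fun u => X u w) (Set.Ici s) s ∧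
    ∃ l : ℝ, Tendsto (fun u => X u w) (𝓝[<] s) (𝓝 l)
  indep : ∀ s u : ℝ≥0, s ≤ u →
    Indep (ℱ s) (MeasurableSpace.comap (fun w => X u w - X s w) inferInstance) Q
  law : ∀ s u : ℝ≥0, s < u →
    Q.map (fun w => X u w - X s w) = vgMeasure σ ν θ ((u : ℝ) - (s : ℝ))

/-- The martingale adjustment `ω_{σ,ν}` of the symmetric model (`θ = 0`). -/
def martingaleAdjustment (σ ν : ℝ) : ℝ :=
  Real.log (1 - σ ^ 2 * ν / 2) / ν

/-- The price process `S_u = S₀ e^{(r + ω_{σ,ν}) u + X_u}` of the symmetric exponential model. -/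
def stockPrice {Ω : Type*} (X : ℝ≥0 → Ω → ℝ) (S₀ r σ ν : ℝ) (u : ℝ≥0) (w : Ω) : ℝ :=
  S₀ * Real.exp ((r + martingaleAdjustment σ ν) * (u : ℝ) + X u w)

open Classical in
/-- The payoff `S_T 1_{S_T > K}` of the asset-or-nothing call. -/
def assetOrNothingPayoff (K x : ℝ) : ℝ :=
  if K < x then x else 0

/-- The value at time `t` of the claim paying `P (S_T)` at time `T`: the conditional expectation,
given the information at time `t`, of the discounted payoff. -/
def claimValue {Ω : Type*} {mΩ : MeasurableSpace Ω} (Q : Measure Ω) (ℱ : Filtration ℝ≥0 mΩ)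
    (X : ℝ≥0 → Ω → ℝ) (S₀ r σ ν : ℝ) (t T : ℝ≥0) (P : ℝ → ℝ) : Ω → ℝ :=
  Q[fun w => Real.exp (-r * ((T : ℝ) - (t : ℝ))) * P (stockPrice X S₀ r σ ν T w) | ℱ t]

/-- The forward strike price `F = K e^{-rτ}`. -/
def forwardStrike (K r τ : ℝ) : ℝ :=
  K * Real.exp (-r * τ)

/-- The risk-neutral moneyness `k_{σ,ν} = log (S/F) + ω_{σ,ν} τ`. -/
def moneyness (S K r τ σ ν : ℝ) : ℝ :=
  Real.log (S / forwardStrike K r τ) + martingaleAdjustment σ ν * τ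

/-- The re-scaled volatility `σ_ν = σ √(ν/2)`. -/
def rescaledVol (σ ν : ℝ) : ℝ :=
  σ * Real.sqrt (ν / 2)

/-- The parameter `α = τ/ν - 1/2`. -/
def alphaParam (τ ν : ℝ) : ℝ :=
  τ / ν - 1 / 2

/-- The quotient `Γ(p(α)) / Γ(q(α))`, read by continuity in `α`: it is the usual quotient when
neither argument is a pole of `Γ`, and the finite limit at a removable singularity. -/
def gammaQuotient (p q : ℝ → ℝ) (α : ℝ) : ℝ :=
  limUnder (𝓝[≠] α) (fun β => Real.Gamma (p β) / Real.Gamma (q β))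

/-- The term of index `(n₁, n₂)` of the double series, with its factor `(-1)^{n₁} / n₁!`. -/
def assetOrNothingTerm (α k s : ℝ) (n : ℕ × ℕ) : ℝ :=
  (-1) ^ n.1 / (n.1 ! : ℝ) *
    (gammaQuotient (fun β => (-(n.1 : ℝ) + (n.2 : ℝ) + 1) / 2 + β)
        (fun _ => (-(n.1 : ℝ) + (n.2 : ℝ)) / 2 + 1) α *
        (-k / s) ^ n.1 * s ^ n.2
      + 2 * gammaQuotient (fun β => -2 * (n.1 : ℝ) - (n.2 : ℝ) - 1 - 2 * β)
        (fun β => -(n.1 : ℝ) + 1 / 2 - β) α *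
        (-k / s) ^ (2 * (n.1 : ℝ) + 1 + 2 * α) * (-k) ^ n.2)

/-- The double series `C⁻(k, s)`, defined for both signs of the second argument. -/
def assetOrNothingSeries (K r τ ν k s : ℝ) : ℝ :=
  forwardStrike K r τ / (2 * Real.Gamma (τ / ν)) *
    ∑' n : ℕ × ℕ, assetOrNothingTerm (alphaParam τ ν) k s n

/-- The term of index `n` of the at-the-money series. -/
def assetOrNothingATMTerm (α s : ℝ) (n : ℕ) : ℝ :=
  Real.Gamma (((n : ℝ) + 1) / 2 + α) / Real.Gamma ((n : ℝ) / 2 + 1) * s ^ n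

end VarianceGamma

end

noncomputable section

namespace VarianceGamma

open Set

/-! Put `a = τ/ν`, `s = σ_ν`, `q = -k/s`. A variance gamma increment over time `τ` is `s` times a
variable whose even density `h` is `symmetricDensity a`. The increment is independent of the past,
so the conditional expectation is an integral against `h`, and the price is `F ∫_{w>q} e^{s(w-q)}
h(w) dw`. This gives the series for `s > 0`, `k ≤ 0`. For `k ≥ 0`, subtract the complementary half
line from the whole line: the moment generating function `(1 - s²)^{-a}` turns the total into `S`,
because `ω` was chosen for that, and evenness of `h` turns the remainder into the same integral with
`-s`. Thus one expansion, valid for `|l| < 1` and `q ≥ 0`, serves both signs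
(`hasSum_standardTerm`).

Expanding the exponential gives `Σ lⁿ Mₙ(q)` with the truncated moments `Mₙ(q) = ∫_q^∞ (w-q)ⁿ/n!
h(w) dw`. These are iterated tail integrals: `M₀' = -h` and `Mₙ₊₁' = -Mₙ`. So the series of `Mₙ`
follows from that of `h` by repeated termwise integration from `0`, the constants of integration
being the explicit moments `Mₙ(0)`. Two families of powers persist: integer powers, whose
coefficients are all values of the single function `momentCoeff`, and powers `q^{2j+N+2α}`, which
acquire no constant (`two_mul_Gamma_mul_truncMoment`).

The density is a Bessel function, `h(v)` being proportional to `besselIntegral (a - 1/2) (v²/4)`,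
and its expansion at non-integer order is proved without complex analysis. The integral and the
candidate series obey the same two rules, `f_α(x) = Γ(α) - ∫₀ˣ f_{α-1}` for `α > 0` and `f_{-α}(x) =
x^{-α} f_α(x)` for `x > 0`. For `0 < α < 1` these give their difference a homogeneous Volterra
equation coupling `α` with `1 - α`, and iteration forces it to vanish. Finally, absolute convergence
of the double series permits the change of summation order, and the reflection formula identifies
its terms with the stated Gamma quotients, including the removable singularities at half-integer
`α`. -/

/-! ### Termwise integration of series of real powers -/

/-- Termwise integration of a series of real powers that converges absolutely at the endpoint. -/
theorem hasSum_integral_rpow {ι : Type*} [Countable ι] {b e : ι → ℝ} {x : ℝ} {f : ℝ → ℝ}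
    (hx : 0 ≤ x) (he : ∀ i, 0 < e i) (hs : Summable fun i => |b i| * x ^ e i)
    (hf : ∀ y ∈ Ioc 0 x, HasSum (fun i => b i * (e i * y ^ (e i - 1))) (f y)) :
    IntervalIntegrable f volume 0 x ∧
      HasSum (fun i => b i * x ^ e i) (∫ y in (0 : ℝ)..x, f y) := by
  have hint : ∀ i, ∫ y in (0 : ℝ)..x, e i * y ^ (e i - 1) = x ^ e i := fun i => by
    rw [intervalIntegral.integral_const_mul, integral_rpow (Or.inl (by linarith [he i]))]
    have h := (he i).ne'
    rw [sub_add_cancel, Real.zero_rpow h]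
    field_simp
    ring
  have hii : ∀ i, IntegrableOn (fun y : ℝ => e i * y ^ (e i - 1)) (Ioc 0 x) := fun i => by
    rw [← intervalIntegrable_iff_integrableOn_Ioc_of_le hx]
    exact (intervalIntegral.intervalIntegrable_rpow' (by linarith [he i])).const_mul _
  -- Each term has constant sign on `(0, x]`, so its `L¹` norm is exactly the endpoint value.
  -- Absolute convergence at `x` is therefore precisely what Fubini needs.
  have hnorm : ∀ i, ∫ y in Ioc 0 x, ‖b i * (e i * y ^ (e i - 1))‖ = |b i| * x ^ e i := fun i => by
    rw [← hint i, intervalIntegral.integral_of_le hx, ← integral_const_mul]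
    refine setIntegral_congr_fun measurableSet_Ioc fun y hy => ?_
    have h1 : 0 ≤ e i * y ^ (e i - 1) := mul_nonneg (he i).le (Real.rpow_nonneg hy.1.le _)
    simp only [norm_mul (b i), Real.norm_eq_abs, abs_of_nonneg h1]
  have hF : ∀ i, Integrable (fun y => b i * (e i * y ^ (e i - 1))) (volume.restrict (Ioc 0 x)) :=
    fun i => (hii i).const_mul _
  have hsum : Summable fun i => ∫ y in Ioc 0 x, ‖b i * (e i * y ^ (e i - 1))‖ := by
    simpa only [hnorm] using hs
  have key := hasSum_integral_of_summable_integral_norm hF hsum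
  have hcongr : ∫ y in Ioc 0 x, ∑' i, b i * (e i * y ^ (e i - 1)) = ∫ y in (0 : ℝ)..x, f y := by
    rw [intervalIntegral.integral_of_le hx]
    exact setIntegral_congr_fun measurableSet_Ioc fun y hy => (hf y hy).tsum_eq
  have hval : ∀ i, ∫ y in Ioc 0 x, b i * (e i * y ^ (e i - 1)) = b i * x ^ e i := fun i => by
    rw [integral_const_mul, ← intervalIntegral.integral_of_le hx, hint]
  refine ⟨?_, by simpa only [hcongr, hval] using key⟩
  rw [intervalIntegrable_iff_integrableOn_Ioc_of_le hx]
  have hmeas : AEStronglyMeasurable f (volume.restrict (Ioc 0 x)) := by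
    have h1 : AEMeasurable (fun y => ∑' i, b i * (e i * y ^ (e i - 1)))
        (volume.restrict (Ioc 0 x)) := by
      refine Measurable.aemeasurable ?_
      fun_prop
    refine (h1.congr ?_).aestronglyMeasurable
    filter_upwards [ae_restrict_mem measurableSet_Ioc] with y hy using (hf y hy).tsum_eq
  refine ⟨hmeas, ?_⟩
  rw [hasFiniteIntegral_iff_enorm]
  calc ∫⁻ y in Ioc 0 x, ‖f y‖ₑ
      ≤ ∫⁻ y in Ioc 0 x, ∑' i, ‖b i * (e i * y ^ (e i - 1))‖ₑ := by
        refine setLIntegral_mono' measurableSet_Ioc fun y hy => ?_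
        rw [← (hf y hy).tsum_eq]
        exact enorm_tsum_le_tsum_enorm
    _ = ∑' i, ∫⁻ y in Ioc 0 x, ‖b i * (e i * y ^ (e i - 1))‖ₑ :=
        lintegral_tsum fun i => (hF i).1.enorm
    _ = ∑' i, ENNReal.ofReal (|b i| * x ^ e i) := by
        refine tsum_congr fun i => ?_
        rw [← hnorm i, ofReal_integral_norm_eq_lintegral_enorm (hF i)]
    _ < ∞ := by
        rw [← ENNReal.ofReal_tsum_of_nonneg
          (fun i => mul_nonneg (abs_nonneg _) (Real.rpow_nonneg hx _)) hs]
        exact ENNReal.ofReal_lt_top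

/-! ### The integral representation of the Bessel function -/

/-- The integral `∫₀^∞ z^{α-1} e^{-z-x/z} dz = 2 x^{α/2} K_α(2√x)`. -/
def besselIntegral (α x : ℝ) : ℝ :=
  ∫ z in Ioi (0 : ℝ), Real.exp (-z) * z ^ (α - 1) * Real.exp (-(x / z))

theorem measurable_besselIntegrand (α : ℝ) :
    Measurable fun p : ℝ × ℝ => Real.exp (-p.1) * p.1 ^ (α - 1) * Real.exp (-(p.2 / p.1)) := by
  fun_prop

theorem integrableOn_besselIntegrand {α x : ℝ} (hα : 0 < α) (hx : 0 ≤ x) :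
    IntegrableOn (fun z => Real.exp (-z) * z ^ (α - 1) * Real.exp (-(x / z))) (Ioi 0) := by
  refine (Real.GammaIntegral_convergent hα).mono' (by fun_prop) ?_
  filter_upwards [ae_restrict_mem measurableSet_Ioi] with z (hz : 0 < z)
  have h1 : 0 ≤ Real.exp (-z) * z ^ (α - 1) := by positivity
  have h2 : Real.exp (-(x / z)) ≤ 1 := by
    rw [Real.exp_le_one_iff, neg_nonpos]
    positivity
  rw [Real.norm_of_nonneg (by positivity)]
  exact mul_le_of_le_one_right h1 h2

/-- The bound `e^{-x/z} ≤ z/x` gains one power of `z` at the origin. This covers the orders `a - 1/2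
> -1/2` of the densities. -/
theorem integrableOn_besselIntegrand_of_pos {α x : ℝ} (hα : -1 < α) (hx : 0 < x) :
    IntegrableOn (fun z => Real.exp (-z) * z ^ (α - 1) * Real.exp (-(x / z))) (Ioi 0) := by
  refine ((Real.GammaIntegral_convergent (show 0 < α + 1 by linarith)).const_mul x⁻¹).mono'
    (by fun_prop) ?_
  filter_upwards [ae_restrict_mem measurableSet_Ioi] with z (hz : 0 < z)
  have h2 : Real.exp (-(x / z)) ≤ x⁻¹ * z := by
    rw [Real.exp_neg, show x⁻¹ * z = (x / z)⁻¹ by field_simp]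
    exact inv_anti₀ (by positivity) (by linarith [Real.add_one_le_exp (x / z)])
  rw [Real.norm_of_nonneg (by positivity)]
  calc Real.exp (-z) * z ^ (α - 1) * Real.exp (-(x / z))
      ≤ Real.exp (-z) * z ^ (α - 1) * (x⁻¹ * z) := by gcongr
    _ = x⁻¹ * (Real.exp (-z) * z ^ (α + 1 - 1)) := by
      rw [show α + 1 - 1 = (α - 1) + 1 by ring, Real.rpow_add_one hz.ne']
      ring

theorem besselIntegral_nonneg (α x : ℝ) : 0 ≤ besselIntegral α x :=
  setIntegral_nonneg measurableSet_Ioi fun z (hz : 0 < z) => by positivity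

theorem besselIntegral_le_Gamma {α x : ℝ} (hα : 0 < α) (hx : 0 ≤ x) :
    besselIntegral α x ≤ Real.Gamma α := by
  rw [Real.Gamma_eq_integral hα]
  refine setIntegral_mono_on (integrableOn_besselIntegrand hα hx)
    (Real.GammaIntegral_convergent hα) measurableSet_Ioi fun z (hz : 0 < z) => ?_
  have h2 : Real.exp (-(x / z)) ≤ 1 := by
    rw [Real.exp_le_one_iff, neg_nonpos]
    positivity
  exact mul_le_of_le_one_right (by positivity) h2

/-- The substitution `z ↦ x/z`, carried out as an inversion followed by a scaling, exchanges the two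
exponentials. -/
theorem besselIntegral_neg {x : ℝ} (α : ℝ) (hx : 0 < x) :
    besselIntegral (-α) x = x ^ (-α) * besselIntegral α x := by
  unfold besselIntegral
  rw [← integral_comp_rpow_Ioi _ (show (-1 : ℝ) ≠ 0 by norm_num)]
  have h := integral_comp_mul_left_Ioi' (fun z : ℝ => (|(-1 : ℝ)| * z ^ ((-1 : ℝ) - 1)) •
    (Real.exp (-z ^ (-1 : ℝ)) * (z ^ (-1 : ℝ)) ^ (-α - 1) *
      Real.exp (-(x / z ^ (-1 : ℝ))))) 0 (inv_pos.mpr hx)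
  rw [mul_zero] at h
  rw [← h, smul_eq_mul, ← integral_const_mul, ← integral_const_mul]
  refine setIntegral_congr_fun measurableSet_Ioi fun z (hz : 0 < z) => ?_
  have h1 : (x⁻¹ * z) ^ (-1 : ℝ) = x / z := by
    rw [Real.rpow_neg_one]
    field_simp
  have h2 : (x⁻¹ * z) ^ ((-1 : ℝ) - 1) = (x / z) ^ 2 := by
    rw [show (-1 : ℝ) - 1 = -1 * (2 : ℕ) by norm_num, Real.rpow_mul_natCast (by positivity), h1]
  have h3 : (x / z) ^ (-α - 1) = x ^ (-α) * z ^ (α - 1) * (z ^ 2 / x) := by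
    rw [Real.div_rpow hx.le hz.le, Real.rpow_sub_one hx.ne', Real.rpow_sub_one hz.ne',
      Real.rpow_neg hz.le, Real.rpow_sub_one hz.ne']
    field_simp
  simp only [smul_eq_mul, h1, h2, h3]
  have h4 : x / (x / z) = z := by field_simp
  rw [h4]
  norm_num
  field_simp

theorem integral_exp_neg_div {x z : ℝ} (hz : 0 < z) :
    ∫ y in (0 : ℝ)..x, Real.exp (-(y / z)) = z * (1 - Real.exp (-(x / z))) := by
  have h : ∀ y ∈ uIcc 0 x, HasDerivAt (fun y => -(z * Real.exp (-(y / z))))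
      (Real.exp (-(y / z))) y := fun y _ => by
    have h1 : HasDerivAt (fun y => -(y / z)) (-(1 / z)) y := ((hasDerivAt_id y).div_const z).neg
    exact (h1.exp.const_mul z).neg.congr_deriv (by field_simp)
  rw [intervalIntegral.integral_eq_sub_of_hasDerivAt h
    (Continuous.intervalIntegrable (by fun_prop) _ _)]
  simp
  ring

/-- Integrate `e^{-y/z}` over `y ∈ (0, x]` inside the defining integral and use Fubini. The order `α
- 1` may be negative, where the integral can diverge at `y = 0`, but that is a null set. -/
theorem besselIntegral_eq_sub {α x : ℝ} (hα : 0 < α) (hx : 0 ≤ x) :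
    IntervalIntegrable (besselIntegral (α - 1)) volume 0 x ∧
      besselIntegral α x = Real.Gamma α - ∫ y in (0 : ℝ)..x, besselIntegral (α - 1) y := by
  have hinner : ∀ z ∈ Ioi (0 : ℝ), (∫ y in Ioc 0 x,
      Real.exp (-z) * z ^ (α - 1 - 1) * Real.exp (-(y / z))) =
      Real.exp (-z) * z ^ (α - 1) - Real.exp (-z) * z ^ (α - 1) * Real.exp (-(x / z)) :=
    fun z (hz : 0 < z) => by
      rw [integral_const_mul, ← intervalIntegral.integral_of_le hx, integral_exp_neg_div hz,
        Real.rpow_sub_one hz.ne']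
      field_simp
  have hdiff : IntegrableOn (fun z => Real.exp (-z) * z ^ (α - 1) -
      Real.exp (-z) * z ^ (α - 1) * Real.exp (-(x / z))) (Ioi 0) :=
    (Real.GammaIntegral_convergent hα).sub (integrableOn_besselIntegrand hα hx)
  have hprod : Integrable (Function.uncurry fun z y : ℝ =>
      Real.exp (-z) * z ^ (α - 1 - 1) * Real.exp (-(y / z)))
      ((volume.restrict (Ioi 0)).prod (volume.restrict (Ioc 0 x))) := by
    refine (integrable_prod_iff
      (measurable_besselIntegrand (α - 1)).aestronglyMeasurable).mpr ⟨?_, ?_⟩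
    · filter_upwards [ae_restrict_mem measurableSet_Ioi] with z (hz : 0 < z)
      have : Continuous fun y : ℝ => Real.exp (-z) * z ^ (α - 1 - 1) * Real.exp (-(y / z)) := by
        fun_prop
      exact this.integrableOn_Ioc
    · refine hdiff.congr ?_
      filter_upwards [ae_restrict_mem measurableSet_Ioi] with z hz
      rw [← hinner z hz]
      refine integral_congr_ae (Eventually.of_forall fun y => ?_)
      have hz' : 0 < z := hz
      exact (Real.norm_of_nonneg (by simp only; positivity)).symm
  refine ⟨(intervalIntegrable_iff_integrableOn_Ioc_of_le hx).mpr hprod.integral_prod_right, ?_⟩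
  have hswap := integral_integral_swap hprod
  rw [setIntegral_congr_fun measurableSet_Ioi hinner, integral_sub
    (Real.GammaIntegral_convergent hα) (integrableOn_besselIntegrand hα hx),
    ← Real.Gamma_eq_integral hα, ← intervalIntegral.integral_of_le hx] at hswap
  unfold besselIntegral
  linarith

/-! ### The series of the Bessel function at a non-integer order -/

theorem exists_pos_le_abs_sub_int {α : ℝ} (hα : ∀ m : ℤ, α ≠ m) :
    ∃ δ : ℝ, 0 < δ ∧ ∀ m : ℤ, δ ≤ |α - m| :=
  ⟨|α - round α|, abs_pos.mpr (sub_ne_zero.mpr (hα _)), round_le α⟩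

/-- Each downward step of the functional equation divides by a number at distance at least `δ` from
`0`. Geometric growth suffices, since the series carry a `1/j!`. -/
theorem abs_Gamma_sub_nat_le {α δ : ℝ} (hδ : 0 < δ) (h : ∀ m : ℤ, δ ≤ |α - m|) (j : ℕ) :
    |Real.Gamma (α - j)| ≤ |Real.Gamma α| * δ⁻¹ ^ j := by
  induction j with
  | zero => simp
  | succ j ih =>
    have hj : δ ≤ |α - (j + 1 : ℕ)| := by simpa using h (j + 1 : ℕ)
    have hne : α - (j + 1 : ℕ) ≠ 0 := abs_pos.mp (hδ.trans_le hj)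
    have hrec : Real.Gamma (α - j) = (α - (j + 1 : ℕ)) * Real.Gamma (α - (j + 1 : ℕ)) := by
      rw [← Real.Gamma_add_one hne]
      congr 1
      push_cast
      ring
    have h1 : δ * |Real.Gamma (α - (j + 1 : ℕ))| ≤ |Real.Gamma α| * δ⁻¹ ^ j := by
      rw [hrec, abs_mul] at ih
      exact (mul_le_mul_of_nonneg_right hj (abs_nonneg _)).trans ih
    rw [pow_succ, ← mul_assoc, ← div_eq_mul_inv, le_div_iff₀ hδ]
    linarith

/-- The coefficients `(-1)^j Γ(α-j) / j!` of the power series in the expansion of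
`besselIntegral`. -/
def besselCoeff (α : ℝ) (j : ℕ) : ℝ := (-1) ^ j / (j ! : ℝ) * Real.Gamma (α - j)

/-- One of the two power series in the expansion of `besselIntegral`. -/
def besselPowerSeries (α x : ℝ) : ℝ := ∑' j, besselCoeff α j * x ^ j

/-- The expansion of `besselIntegral` at a non-integer order. -/
def besselSeries (α x : ℝ) : ℝ := besselPowerSeries α x + x ^ α * besselPowerSeries (-α) x

theorem not_int_neg {α : ℝ} (hα : ∀ m : ℤ, α ≠ m) : ∀ m : ℤ, -α ≠ m := fun m h =>
  hα (-m) (by push_cast; linarith)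

theorem not_int_sub_one {α : ℝ} (hα : ∀ m : ℤ, α ≠ m) : ∀ m : ℤ, α - 1 ≠ m := fun m h =>
  hα (m + 1) (by push_cast; linarith)

theorem summable_abs_besselCoeff {α : ℝ} (hα : ∀ m : ℤ, α ≠ m) (x : ℝ) :
    Summable fun j : ℕ => |besselCoeff α j * x ^ j| := by
  obtain ⟨δ, hδ, h⟩ := exists_pos_le_abs_sub_int hα
  refine Summable.of_nonneg_of_le (fun j => abs_nonneg _) (fun j => ?_)
    ((Real.summable_pow_div_factorial (δ⁻¹ * |x|)).mul_left |Real.Gamma α|)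
  have hj : (0 : ℝ) < j ! := by positivity
  rw [besselCoeff, abs_mul, abs_mul, abs_div, abs_pow, abs_neg, abs_one, one_pow, abs_pow,
    abs_of_pos hj, mul_pow]
  calc 1 / (j ! : ℝ) * |Real.Gamma (α - j)| * |x| ^ j
      ≤ 1 / (j ! : ℝ) * (|Real.Gamma α| * δ⁻¹ ^ j) * |x| ^ j := by
        gcongr
        exact abs_Gamma_sub_nat_le hδ h j
    _ = _ := by ring

theorem hasSum_besselPowerSeries {α : ℝ} (hα : ∀ m : ℤ, α ≠ m) (x : ℝ) :
    HasSum (fun j : ℕ => besselCoeff α j * x ^ j) (besselPowerSeries α x) :=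
  (summable_abs_besselCoeff hα x).of_abs.hasSum

/-- Coefficient form of `P_α' = -P_{α-1}` for the power series `P_α`. The next lemma is the analogue
for `x^α P_{-α}`, by the functional equation of `Γ`. -/
theorem besselCoeff_succ (α : ℝ) (j : ℕ) :
    besselCoeff α (j + 1) * ((j : ℝ) + 1) = -besselCoeff (α - 1) j := by
  have hj : (0 : ℝ) < j ! := by positivity
  have hj' : (j : ℝ) + 1 ≠ 0 := by positivity
  simp only [besselCoeff, Nat.factorial_succ]
  rw [show α - ((j + 1 : ℕ) : ℝ) = α - 1 - j by push_cast; ring]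
  push_cast
  field_simp
  ring

theorem besselCoeff_neg_mul {α : ℝ} (hα : ∀ m : ℤ, α ≠ m) (j : ℕ) :
    besselCoeff (-α) j * (α + j) = -besselCoeff (-(α - 1)) j := by
  have hne : -α - j ≠ 0 := fun h => hα (-j) (by push_cast; linarith)
  simp only [besselCoeff]
  rw [show -(α - 1) - (j : ℝ) = -α - j + 1 by ring, Real.Gamma_add_one hne]
  ring

theorem besselPowerSeries_eq_sub {α x : ℝ} (hα : ∀ m : ℤ, α ≠ m) (hx : 0 ≤ x) :
    IntervalIntegrable (besselPowerSeries (α - 1)) volume 0 x ∧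
      besselPowerSeries α x =
        Real.Gamma α - ∫ y in (0 : ℝ)..x, besselPowerSeries (α - 1) y := by
  have hs : Summable fun j : ℕ => |besselCoeff α (j + 1)| * x ^ ((j : ℝ) + 1) := by
    refine ((summable_nat_add_iff 1).mpr (summable_abs_besselCoeff hα x)).congr fun j => ?_
    rw [abs_mul, abs_of_nonneg (pow_nonneg hx _), ← Nat.cast_succ, Real.rpow_natCast]
  obtain ⟨h1, h2⟩ := hasSum_integral_rpow (b := fun j : ℕ => besselCoeff α (j + 1))
    (e := fun j => (j : ℝ) + 1) (f := fun y => -besselPowerSeries (α - 1) y) hx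
    (fun j => by positivity) hs (fun y hy => by
      refine (hasSum_besselPowerSeries (not_int_sub_one hα) y).neg.congr_fun fun j => ?_
      rw [← mul_assoc, besselCoeff_succ, add_sub_cancel_right, Real.rpow_natCast, neg_mul])
  refine ⟨by simpa [Pi.neg_def] using h1.neg, ?_⟩
  rw [besselPowerSeries, (summable_abs_besselCoeff hα x).of_abs.tsum_eq_zero_add]
  rw [intervalIntegral.integral_neg] at h2
  have h3 : HasSum (fun j : ℕ => besselCoeff α (j + 1) * x ^ (j + 1))
      (-∫ y in (0 : ℝ)..x, besselPowerSeries (α - 1) y) := by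
    refine h2.congr_fun fun j => ?_
    rw [← Nat.cast_succ, Real.rpow_natCast]
  rw [h3.tsum_eq]
  simp [besselCoeff]
  ring

/-- All exponents `α + j` are positive, so nothing survives at `0`; the constant `Γ(α)` in
`besselSeries_eq_sub` comes from the other power series alone. -/
theorem rpow_mul_besselPowerSeries_eq {α x : ℝ} (hα0 : 0 < α) (hα : ∀ m : ℤ, α ≠ m)
    (hx : 0 ≤ x) :
    IntervalIntegrable (fun y => y ^ (α - 1) * besselPowerSeries (-(α - 1)) y) volume 0 x ∧
      x ^ α * besselPowerSeries (-α) x =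
        -∫ y in (0 : ℝ)..x, y ^ (α - 1) * besselPowerSeries (-(α - 1)) y := by
  have hpow : ∀ j : ℕ, x ^ (α + j) = x ^ α * x ^ j := fun j => by
    rw [Real.rpow_add_of_nonneg hx hα0.le (by positivity), Real.rpow_natCast]
  have hs : Summable fun j : ℕ => |besselCoeff (-α) j| * x ^ (α + j) := by
    refine ((summable_abs_besselCoeff (not_int_neg hα) x).mul_left (x ^ α)).congr fun j => ?_
    rw [abs_mul, abs_of_nonneg (pow_nonneg hx _), hpow]
    ring
  obtain ⟨h1, h2⟩ := hasSum_integral_rpow (b := fun j : ℕ => besselCoeff (-α) j)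
    (e := fun j => α + j) (f := fun y => -(y ^ (α - 1) * besselPowerSeries (-(α - 1)) y)) hx
    (fun j => by positivity) hs (fun y hy => by
      refine ((hasSum_besselPowerSeries (not_int_neg (not_int_sub_one hα)) y).mul_left
        (y ^ (α - 1))).neg.congr_fun fun j => ?_
      rw [← mul_assoc, besselCoeff_neg_mul hα, show α + (j : ℝ) - 1 = α - 1 + j by ring,
        Real.rpow_add hy.1, Real.rpow_natCast]
      ring)
  refine ⟨by simpa [Pi.neg_def] using h1.neg, ?_⟩
  rw [intervalIntegral.integral_neg] at h2
  refine HasSum.unique ?_ h2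
  refine ((hasSum_besselPowerSeries (not_int_neg hα) x).mul_left (x ^ α)).congr_fun fun j => ?_
  rw [hpow]
  ring

theorem besselSeries_eq_sub {α x : ℝ} (hα0 : 0 < α) (hα : ∀ m : ℤ, α ≠ m) (hx : 0 ≤ x) :
    IntervalIntegrable (besselSeries (α - 1)) volume 0 x ∧
      besselSeries α x = Real.Gamma α - ∫ y in (0 : ℝ)..x, besselSeries (α - 1) y := by
  obtain ⟨h1, h2⟩ := besselPowerSeries_eq_sub hα hx
  obtain ⟨h3, h4⟩ := rpow_mul_besselPowerSeries_eq hα0 hα hx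
  refine ⟨h1.add h3, ?_⟩
  unfold besselSeries
  rw [intervalIntegral.integral_add h1 h3, h2, h4]
  ring

theorem besselSeries_neg {x : ℝ} (α : ℝ) (hx : 0 < x) :
    besselSeries (-α) x = x ^ (-α) * besselSeries α x := by
  have h : x ^ (-α) * x ^ α = 1 := by rw [← Real.rpow_add hx]; simp
  simp only [besselSeries, neg_neg]
  linear_combination -besselPowerSeries (-α) x * h

theorem abs_besselPowerSeries_le {α x y : ℝ} (hα : ∀ m : ℤ, α ≠ m) (hy : y ∈ Ioc 0 x) :
    |besselPowerSeries α y| ≤ ∑' j, |besselCoeff α j * x ^ j| := by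
  rw [← Real.norm_eq_abs, besselPowerSeries]
  refine tsum_of_norm_bounded (summable_abs_besselCoeff hα x).hasSum fun j => ?_
  rw [Real.norm_eq_abs, abs_mul, abs_mul]
  rw [abs_pow, abs_pow]
  exact mul_le_mul_of_nonneg_left
    (pow_le_pow_left₀ (abs_nonneg _) (abs_le_abs_of_nonneg hy.1.le hy.2) j) (abs_nonneg _)

theorem exists_abs_besselSeries_le {α : ℝ} (hα0 : 0 < α) (hα : ∀ m : ℤ, α ≠ m) (x : ℝ) :
    ∃ M, ∀ y ∈ Ioc 0 x, |besselSeries α y| ≤ M := by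
  refine ⟨(∑' j, |besselCoeff α j * x ^ j|) + x ^ α * ∑' j, |besselCoeff (-α) j * x ^ j|,
    fun y hy => ?_⟩
  have h0 := Real.rpow_nonneg hy.1.le α
  have h3 : y ^ α ≤ x ^ α := Real.rpow_le_rpow hy.1.le hy.2 hα0.le
  refine (abs_add_le _ _).trans (add_le_add (abs_besselPowerSeries_le hα hy) ?_)
  rw [abs_mul, abs_of_nonneg h0]
  exact mul_le_mul h3 (abs_besselPowerSeries_le (not_int_neg hα) hy) (abs_nonneg _) (h0.trans h3)

/-! ### Equality of the integral and the series -/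

/-- The constants `Γ(α)` cancel, and reflection replaces the order `α - 1` by `1 - α`. For `0 < α <
1` the new order stays in `(0, 1)`, so the equation can be iterated. -/
theorem besselDiff_eq {α x : ℝ} (hα0 : 0 < α) (hα : ∀ m : ℤ, α ≠ m) (hx : 0 ≤ x) :
    besselIntegral α x - besselSeries α x = -∫ y in (0 : ℝ)..x,
      y ^ (α - 1) * (besselIntegral (1 - α) y - besselSeries (1 - α) y) := by
  obtain ⟨h1, h2⟩ := besselIntegral_eq_sub hα0 hx
  obtain ⟨h3, h4⟩ := besselSeries_eq_sub hα0 hα hx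
  have h5 : ∫ y in (0 : ℝ)..x,
      y ^ (α - 1) * (besselIntegral (1 - α) y - besselSeries (1 - α) y) =
      ∫ y in (0 : ℝ)..x, (besselIntegral (α - 1) y - besselSeries (α - 1) y) := by
    rw [intervalIntegral.integral_of_le hx, intervalIntegral.integral_of_le hx]
    refine setIntegral_congr_fun measurableSet_Ioc fun y hy => ?_
    have e1 := besselIntegral_neg (1 - α) hy.1
    have e2 := besselSeries_neg (1 - α) hy.1
    rw [neg_sub] at e1 e2
    simp only [e1, e2]
    ring
  rw [h5, intervalIntegral.integral_sub h1 h3, h2, h4]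
  ring

theorem abs_besselDiff_le {α C r X : ℝ} (hα0 : 0 < α) (hα : ∀ m : ℤ, α ≠ m) (hr : 0 ≤ r)
    (hC : ∀ y ∈ Ioc 0 X, |besselIntegral (1 - α) y - besselSeries (1 - α) y| ≤ C * y ^ r)
    {x : ℝ} (hx : x ∈ Ioc 0 X) :
    |besselIntegral α x - besselSeries α x| ≤ C / (r + α) * x ^ (r + α) := by
  rw [besselDiff_eq hα0 hα hx.1.le, abs_neg, ← Real.norm_eq_abs]
  have hi : IntervalIntegrable (fun y : ℝ => C * y ^ (r + α - 1)) volume 0 x :=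
    (intervalIntegral.intervalIntegrable_rpow' (by linarith)).const_mul C
  refine (intervalIntegral.norm_integral_le_of_norm_le hx.1.le
    (Eventually.of_forall fun y hy => ?_) hi).trans_eq ?_
  · rw [norm_mul, Real.norm_of_nonneg (Real.rpow_nonneg hy.1.le _), Real.norm_eq_abs,
      show r + α - 1 = α - 1 + r by ring, Real.rpow_add hy.1]
    have := mul_le_mul_of_nonneg_left (hC y ⟨hy.1, hy.2.trans hx.2⟩)
      (Real.rpow_nonneg hy.1.le (α - 1))
    linarith
  · rw [intervalIntegral.integral_const_mul, integral_rpow (Or.inl (by linarith)),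
      sub_add_cancel, Real.zero_rpow (by linarith)]
    ring

theorem besselIntegral_eq_besselSeries_of_lt_one {α x : ℝ} (hα0 : 0 < α) (hα1 : α < 1)
    (hx : 0 < x) : besselIntegral α x = besselSeries α x := by
  have hint : ∀ β : ℝ, 0 < β → β < 1 → ∀ m : ℤ, β ≠ m := fun β h0 h1 m h => by
    subst h
    have h0' : 0 < m := by exact_mod_cast h0
    have h1' : m < 1 := by exact_mod_cast h1
    omega
  set D : ℝ → ℝ → ℝ := fun β y => besselIntegral β y - besselSeries β y with hD
  have hbd : ∀ β : ℝ, 0 < β → β < 1 → ∃ M, ∀ y ∈ Ioc 0 x, |D β y| ≤ M := fun β h0 h1 => by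
    obtain ⟨M, hM⟩ := exists_abs_besselSeries_le h0 (hint β h0 h1) x
    refine ⟨Real.Gamma β + M, fun y hy => (abs_sub _ _).trans (add_le_add ?_ (hM y hy))⟩
    rw [abs_of_nonneg (besselIntegral_nonneg _ _)]
    exact besselIntegral_le_Gamma h0 hy.1.le
  obtain ⟨M₁, hM₁⟩ := hbd α hα0 hα1
  obtain ⟨M₂, hM₂⟩ := hbd (1 - α) (by linarith) (by linarith)
  set M := max M₁ M₂
  set δ := min α (1 - α)
  have hδ : 0 < δ := lt_min hα0 (by linarith)
  have hM0 : 0 ≤ M := (abs_nonneg _).trans ((hM₁ x ⟨hx, le_rfl⟩).trans (le_max_left _ _))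
  -- Two uses of the Volterra equation, from `β` to `1 - β` and back, raise the exponent by exactly
  -- `1` and divide by `(m + 1 - β)(m + 1)`. The second factor builds the factorial; the first is
  -- merely bounded below by `δ`.
  have step : ∀ m : ℕ, ∀ β : ℝ, (β = α ∨ β = 1 - α) → ∀ y ∈ Ioc 0 x,
      |D β y| ≤ M * δ⁻¹ ^ m / (m ! : ℝ) * y ^ (m : ℝ) := by
    intro m
    induction m with
    | zero =>
      rintro β (rfl | rfl) y hy
      · simpa only [pow_zero, Nat.factorial_zero, Nat.cast_zero, Nat.cast_one, mul_one, div_one,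
          Real.rpow_zero] using (hM₁ y hy).trans (le_max_left _ _)
      · simpa only [pow_zero, Nat.factorial_zero, Nat.cast_zero, Nat.cast_one, mul_one, div_one,
          Real.rpow_zero] using (hM₂ y hy).trans (le_max_right _ _)
    | succ m ih =>
      intro β hβ y hy
      have hβ0 : 0 < β := by rcases hβ with rfl | rfl <;> linarith
      have hβ1 : β < 1 := by rcases hβ with rfl | rfl <;> linarith
      have hβδ : δ ≤ 1 - β := by
        rcases hβ with rfl | rfl
        · exact min_le_right _ _
        · exact (min_le_left _ _).trans_eq (by ring)
      have h1 : ∀ z ∈ Ioc 0 x, |D (1 - β) z| ≤ _ := fun z hz =>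
        abs_besselDiff_le (X := x) (r := (m : ℝ)) (by linarith)
          (hint (1 - β) (by linarith) (by linarith)) (by positivity)
          (fun w hw => by rw [sub_sub_cancel]; exact ih β hβ w hw) hz
      have h2 := abs_besselDiff_le hβ0 (hint β hβ0 hβ1)
        (show 0 ≤ (m : ℝ) + (1 - β) by have : 0 ≤ (m : ℝ) := m.cast_nonneg; linarith) h1 hy
      have hy' := Real.rpow_nonneg hy.1.le ((m + 1 : ℕ) : ℝ)
      rw [show (m : ℝ) + (1 - β) + β = ((m + 1 : ℕ) : ℝ) by push_cast; ring] at h2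
      refine h2.trans (mul_le_mul_of_nonneg_right ?_ hy')
      have hm : (0 : ℝ) < m ! := by positivity
      rw [Nat.factorial_succ, pow_succ]
      calc M * δ⁻¹ ^ m / (m ! : ℝ) / ((m : ℝ) + (1 - β)) / ((m + 1 : ℕ) : ℝ)
          ≤ M * δ⁻¹ ^ m / (m ! : ℝ) / δ / ((m + 1 : ℕ) : ℝ) := by
            gcongr
            linarith [show (0 : ℝ) ≤ m from m.cast_nonneg]
        _ = _ := by
            push_cast
            field_simp
  have hlim : Tendsto (fun m : ℕ => M * ((δ⁻¹ * x) ^ m / (m ! : ℝ))) atTop (𝓝 (M * 0)) :=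
    (FloorSemiring.tendsto_pow_div_factorial_atTop _).const_mul M
  rw [mul_zero] at hlim
  have hle : |D α x| ≤ 0 := ge_of_tendsto' hlim fun m => by
    refine (step m α (Or.inl rfl) x ⟨hx, le_rfl⟩).trans_eq ?_
    rw [Real.rpow_natCast, mul_pow]
    ring
  exact sub_eq_zero.mp (abs_nonpos_iff.mp hle)

theorem besselIntegral_eq_besselSeries {α x : ℝ} (hα : -1 < α) (hαint : ∀ m : ℤ, α ≠ m)
    (hx : 0 < x) : besselIntegral α x = besselSeries α x := by
  obtain ⟨n, hn⟩ := exists_nat_gt α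
  induction n generalizing α x with
  -- Here `-1 < α < 0`: reflection reduces to `-α ∈ (0, 1)`.
  | zero =>
    have h := besselIntegral_eq_besselSeries_of_lt_one (α := -α) (x := x)
      (by simpa using hn) (by linarith) hx
    have e1 := besselIntegral_neg (-α) hx
    have e2 := besselSeries_neg (-α) hx
    rw [neg_neg] at e1 e2
    rw [e1, e2, h]
  | succ n ih =>
    rcases lt_or_ge α n with h | h
    · exact ih hα hαint hx h
    have hα0 : 0 < α := lt_of_le_of_ne (le_trans (by positivity) h)
      fun h0 => hαint 0 (by simpa using h0.symm)
    rw [(besselIntegral_eq_sub hα0 hx.le).2, (besselSeries_eq_sub hα0 hαint hx.le).2,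
      intervalIntegral.integral_of_le hx.le, intervalIntegral.integral_of_le hx.le]
    congr 1
    refine setIntegral_congr_fun measurableSet_Ioc fun y hy => ?_
    exact ih (by linarith) (not_int_sub_one hαint) hy.1 (by push_cast at hn; linarith)

/-! ### The standard symmetric variance gamma density -/

/-- The density of `√(2Z) N`, where `N` is standard normal and `Z` has the Gamma law of shape `a`
and rate `1`. -/
def symmetricDensity (a v : ℝ) : ℝ :=
  besselIntegral (a - 1 / 2) (v ^ 2 / 4) / (2 * √Real.pi * Real.Gamma a)

theorem symmetricDensity_nonneg {a : ℝ} (ha : 0 < a) (v : ℝ) : 0 ≤ symmetricDensity a v := by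
  have := besselIntegral_nonneg (a - 1 / 2) (v ^ 2 / 4)
  have := Real.Gamma_pos_of_pos ha
  unfold symmetricDensity
  positivity

theorem symmetricDensity_neg (a v : ℝ) : symmetricDensity a (-v) = symmetricDensity a v := by
  simp [symmetricDensity]

theorem measurable_symmetricDensity (a : ℝ) : Measurable (symmetricDensity a) := by
  have h : StronglyMeasurable (besselIntegral (a - 1 / 2)) := by
    have h1 : StronglyMeasurable fun p : ℝ × ℝ =>
        Real.exp (-p.2) * p.2 ^ (a - 1 / 2 - 1) * Real.exp (-(p.1 / p.2)) :=
      Measurable.stronglyMeasurable (by fun_prop)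
    exact h1.integral_prod_right
  unfold symmetricDensity
  exact (h.measurable.comp (by fun_prop : Measurable fun v : ℝ => v ^ 2 / 4)).div_const _

/-- The density is a Gamma mixture of centred Gaussians of variance `2z`. By Fubini, moments and
exponential moments reduce to the Gaussian integral `W z`, followed by a Gamma integral in `z`. -/
theorem integral_mul_besselIntegral {α : ℝ} {w W : ℝ → ℝ} {s : Set ℝ} (hs : MeasurableSet s)
    (hw : Measurable w) (hw0 : ∀ v ∈ s, 0 ≤ w v)
    (hin : ∀ z, 0 < z → IntegrableOn (fun v => w v * Real.exp (-(v ^ 2 / 4 / z))) s)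
    (hW : ∀ z, 0 < z → ∫ v in s, w v * Real.exp (-(v ^ 2 / 4 / z)) = W z)
    (hout : IntegrableOn (fun z => Real.exp (-z) * z ^ (α - 1) * W z) (Ioi 0)) :
    IntegrableOn (fun v => w v * besselIntegral α (v ^ 2 / 4)) s ∧
      ∫ v in s, w v * besselIntegral α (v ^ 2 / 4) =
        ∫ z in Ioi (0 : ℝ), Real.exp (-z) * z ^ (α - 1) * W z := by
  have hprod : Integrable (Function.uncurry fun z v : ℝ =>
      Real.exp (-z) * z ^ (α - 1) * (w v * Real.exp (-(v ^ 2 / 4 / z))))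
      ((volume.restrict (Ioi 0)).prod (volume.restrict s)) := by
    refine (integrable_prod_iff (Measurable.aestronglyMeasurable ?_)).mpr ⟨?_, ?_⟩
    · simp only [Function.uncurry_def]
      fun_prop
    · filter_upwards [ae_restrict_mem measurableSet_Ioi] with z (hz : 0 < z)
      exact (hin z hz).const_mul (Real.exp (-z) * z ^ (α - 1))
    · refine hout.congr ?_
      filter_upwards [ae_restrict_mem measurableSet_Ioi] with z (hz : 0 < z)
      rw [← hW z hz, ← integral_const_mul]
      refine setIntegral_congr_fun hs fun v hv => ?_
      have := hw0 v hv
      exact (Real.norm_of_nonneg (by positivity)).symm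
  have hinner : ∀ v, ∫ z in Ioi (0 : ℝ),
      Real.exp (-z) * z ^ (α - 1) * (w v * Real.exp (-(v ^ 2 / 4 / z))) =
      w v * besselIntegral α (v ^ 2 / 4) := fun v => by
    rw [besselIntegral, ← integral_const_mul]
    congr 1 with z
    ring
  refine ⟨(hprod.integral_prod_right).congr (Eventually.of_forall hinner), ?_⟩
  have hswap := integral_integral_swap hprod
  simp only [hinner] at hswap
  rw [← hswap]
  refine setIntegral_congr_fun measurableSet_Ioi fun z hz => ?_
  rw [integral_const_mul, hW z hz]

theorem integrableOn_rpow_mul_exp_neg_mul {a r : ℝ} (ha : 0 < a) (hr : 0 < r) :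
    IntegrableOn (fun z : ℝ => z ^ (a - 1) * Real.exp (-(r * z))) (Ioi 0) := by
  -- The Bochner integral of a non-integrable function is `0` by convention, so a nonzero value
  -- certifies integrability. The same device is used below.
  refine Integrable.of_integral_ne_zero ?_
  rw [Real.integral_rpow_mul_exp_neg_mul_Ioi ha hr]
  have := Real.Gamma_pos_of_pos ha
  positivity

theorem integral_pow_mul_exp_neg_sq_div (n : ℕ) {z : ℝ} (hz : 0 < z) :
    ∫ v in Ioi (0 : ℝ), v ^ n * Real.exp (-(v ^ 2 / 4 / z)) =
      2 ^ n * Real.Gamma ((n + 1) / 2) * z ^ (((n : ℝ) + 1) / 2) := by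
  have h := integral_rpow_mul_exp_neg_mul_rpow (p := 2) (q := n) (b := 1 / (4 * z)) (by norm_num)
    (by linarith [show (0 : ℝ) ≤ n from n.cast_nonneg]) (by positivity)
  have h1 : (1 / (4 * z)) ^ (-((n : ℝ) + 1) / 2) = 2 ^ (n + 1) * z ^ (((n : ℝ) + 1) / 2) := by
    rw [one_div, Real.inv_rpow (by positivity), ← Real.rpow_neg (by positivity),
      Real.mul_rpow (by norm_num) hz.le, show (4 : ℝ) = 2 ^ (2 : ℝ) by norm_num,
      ← Real.rpow_mul (by norm_num), ← Real.rpow_natCast]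
    push_cast
    congr 2 <;> ring
  rw [h1] at h
  rw [show 2 ^ n * Real.Gamma ((n + 1) / 2) * z ^ (((n : ℝ) + 1) / 2) =
    2 ^ (n + 1) * z ^ (((n : ℝ) + 1) / 2) * (1 / 2) * Real.Gamma ((n + 1) / 2) by ring, ← h]
  refine setIntegral_congr_fun measurableSet_Ioi fun v (hv : 0 < v) => ?_
  have h2 : v ^ (2 : ℝ) = v ^ 2 := by exact_mod_cast Real.rpow_natCast v 2
  simp only [Real.rpow_natCast, h2]
  congr 2
  field_simp

/-- Legendre duplication at `(n+1)/2`. It turns the Gaussian moment factor into `n!/Γ(n/2+1)`, the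
form appearing in the double series. -/
theorem Gamma_half_mul_Gamma (n : ℕ) :
    2 ^ n * Real.Gamma (((n : ℝ) + 1) / 2) * Real.Gamma ((n : ℝ) / 2 + 1) = (n ! : ℝ) * √Real.pi := by
  have h := Real.Gamma_mul_Gamma_add_half (((n : ℝ) + 1) / 2)
  rw [show ((n : ℝ) + 1) / 2 + 1 / 2 = (n : ℝ) / 2 + 1 by ring,
    show 2 * (((n : ℝ) + 1) / 2) = (n : ℝ) + 1 by ring, Real.Gamma_nat_eq_factorial,
    show 1 - ((n : ℝ) + 1) = -(n : ℝ) by ring, Real.rpow_neg (by norm_num), Real.rpow_natCast] at h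
  rw [mul_assoc, h]
  field_simp

/-- The absolute moments of the standard symmetric variance gamma law. -/
theorem integral_pow_mul_symmetricDensity {a : ℝ} (ha : 0 < a) (n : ℕ) :
    IntegrableOn (fun v => v ^ n * symmetricDensity a v) (Ioi 0) ∧
      ∫ v in Ioi (0 : ℝ), v ^ n * symmetricDensity a v =
        n ! * (Real.Gamma (a + n / 2) / Real.Gamma (n / 2 + 1)) / (2 * Real.Gamma a) := by
  have hG := Real.Gamma_pos_of_pos ha
  have ha' : 0 < a + (n : ℝ) / 2 := by positivity
  have hcongr : ∀ z ∈ Ioi (0 : ℝ), Real.exp (-z) * z ^ (a - 1 / 2 - 1) *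
      (2 ^ n * Real.Gamma ((n + 1) / 2) * z ^ (((n : ℝ) + 1) / 2)) =
      2 ^ n * Real.Gamma ((n + 1) / 2) * (Real.exp (-z) * z ^ (a + (n : ℝ) / 2 - 1)) :=
    fun z (hz : 0 < z) => by
      rw [show a + (n : ℝ) / 2 - 1 = (a - 1 / 2 - 1) + ((n : ℝ) + 1) / 2 by ring,
        Real.rpow_add hz]
      ring
  obtain ⟨h1, h2⟩ := integral_mul_besselIntegral (α := a - 1 / 2) (w := fun v => v ^ n)
    (W := fun z => 2 ^ n * Real.Gamma ((n + 1) / 2) * z ^ (((n : ℝ) + 1) / 2)) measurableSet_Ioi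
    (by fun_prop) (fun v (hv : 0 < v) => by positivity)
    (fun z hz => by
      refine Integrable.of_integral_ne_zero ?_
      rw [integral_pow_mul_exp_neg_sq_div n hz]
      have := Real.Gamma_pos_of_pos (show 0 < ((n : ℝ) + 1) / 2 by positivity)
      positivity)
    (fun z hz => integral_pow_mul_exp_neg_sq_div n hz)
    (IntegrableOn.congr_fun ((Real.GammaIntegral_convergent ha').const_mul _)
      (fun z hz => (hcongr z hz).symm) measurableSet_Ioi)
  have hc : ∀ v : ℝ, v ^ n * symmetricDensity a v =
      v ^ n * besselIntegral (a - 1 / 2) (v ^ 2 / 4) / (2 * √Real.pi * Real.Gamma a) :=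
    fun v => by rw [symmetricDensity]; ring
  simp only [hc]
  refine ⟨h1.div_const _, ?_⟩
  rw [integral_div, h2, setIntegral_congr_fun measurableSet_Ioi hcongr, integral_const_mul,
    ← Real.Gamma_eq_integral ha']
  have hd := Real.Gamma_pos_of_pos (show 0 < (n : ℝ) / 2 + 1 by positivity)
  have hpi : 0 < √Real.pi := Real.sqrt_pos.mpr Real.pi_pos
  have hdup := Gamma_half_mul_Gamma n
  generalize Real.Gamma (a + n / 2) = G₁
  generalize Real.Gamma ((n : ℝ) / 2 + 1) = G₂ at *
  generalize Real.Gamma (((n : ℝ) + 1) / 2) = G₃ at *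
  field_simp
  linear_combination G₁ * hdup

theorem integral_exp_mul_exp_neg_sq_div (l : ℝ) {z : ℝ} (hz : 0 < z) :
    ∫ v : ℝ, Real.exp (l * v) * Real.exp (-(v ^ 2 / 4 / z)) =
      2 * √Real.pi * (z ^ (1 / 2 : ℝ) * Real.exp (l ^ 2 * z)) := by
  have h : ∀ v : ℝ, Real.exp (l * v) * Real.exp (-(v ^ 2 / 4 / z)) =
      Real.exp (l ^ 2 * z) * Real.exp (-(1 / (4 * z)) * (v - 2 * l * z) ^ 2) := fun v => by
    rw [← Real.exp_add, ← Real.exp_add]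
    congr 1
    field_simp
    ring
  simp only [h]
  rw [integral_const_mul, integral_sub_right_eq_self
    (fun v => Real.exp (-(1 / (4 * z)) * v ^ 2)), integral_gaussian,
    show Real.pi / (1 / (4 * z)) = 2 ^ 2 * Real.pi * z by field_simp; norm_num,
    Real.sqrt_mul (by positivity), Real.sqrt_mul (by positivity),
    Real.sqrt_sq (by norm_num), ← Real.sqrt_eq_rpow]
  ring

/-- The moment generating function of the standard symmetric variance gamma law. -/
theorem integral_exp_mul_symmetricDensity {a l : ℝ} (ha : 0 < a) (hl : |l| < 1) :
    Integrable (fun v => Real.exp (l * v) * symmetricDensity a v) ∧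
      ∫ v, Real.exp (l * v) * symmetricDensity a v = (1 - l ^ 2) ^ (-a) := by
  have hG := Real.Gamma_pos_of_pos ha
  have hl2 : 0 < 1 - l ^ 2 := by
    have := (sq_lt_one_iff_abs_lt_one l).mpr hl
    linarith
  have hpi : 0 < √Real.pi := Real.sqrt_pos.mpr Real.pi_pos
  have hcongr : ∀ z ∈ Ioi (0 : ℝ), Real.exp (-z) * z ^ (a - 1 / 2 - 1) *
      (2 * √Real.pi * (z ^ (1 / 2 : ℝ) * Real.exp (l ^ 2 * z))) =
      2 * √Real.pi * (z ^ (a - 1) * Real.exp (-((1 - l ^ 2) * z))) :=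
    fun z (hz : 0 < z) => by
      rw [show -((1 - l ^ 2) * z) = -z + l ^ 2 * z by ring, Real.exp_add,
        show a - 1 = (a - 1 / 2 - 1) + 1 / 2 by ring, Real.rpow_add hz]
      ring
  obtain ⟨h1, h2⟩ := integral_mul_besselIntegral (α := a - 1 / 2)
    (w := fun v => Real.exp (l * v))
    (W := fun z => 2 * √Real.pi * (z ^ (1 / 2 : ℝ) * Real.exp (l ^ 2 * z))) MeasurableSet.univ
    (by fun_prop) (fun v _ => by positivity)
    (fun z hz => by
      refine Integrable.of_integral_ne_zero ?_
      rw [Measure.restrict_univ, integral_exp_mul_exp_neg_sq_div l hz]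
      positivity)
    (fun z hz => by rw [Measure.restrict_univ, integral_exp_mul_exp_neg_sq_div l hz])
    (IntegrableOn.congr_fun ((integrableOn_rpow_mul_exp_neg_mul ha hl2).const_mul _)
      (fun z hz => (hcongr z hz).symm) measurableSet_Ioi)
  rw [integrableOn_univ] at h1
  rw [Measure.restrict_univ, setIntegral_congr_fun measurableSet_Ioi hcongr, integral_const_mul,
    Real.integral_rpow_mul_exp_neg_mul_Ioi ha hl2] at h2
  have hc : ∀ v : ℝ, Real.exp (l * v) * symmetricDensity a v =
      Real.exp (l * v) * besselIntegral (a - 1 / 2) (v ^ 2 / 4) /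
        (2 * √Real.pi * Real.Gamma a) :=
    fun v => by rw [symmetricDensity]; ring
  simp only [hc]
  refine ⟨h1.div_const _, ?_⟩
  rw [integral_div, h2, Real.rpow_neg hl2.le, one_div, Real.inv_rpow hl2.le]
  field_simp

/-! ### Truncated moments -/

/-- The truncated moment `∫_q^∞ (w-q)^n / n! h(w) dw`. -/
def truncMoment (h : ℝ → ℝ) (n : ℕ) (q : ℝ) : ℝ :=
  ∫ w in Ioi q, (w - q) ^ n / (n ! : ℝ) * h w

theorem truncMoment_zero_eq_sub {h : ℝ → ℝ} {q : ℝ} (hq : 0 ≤ q)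
    (hh : IntegrableOn h (Ioi 0)) :
    IntervalIntegrable h volume 0 q ∧
      truncMoment h 0 q = truncMoment h 0 0 - ∫ y in (0 : ℝ)..q, h y := by
  simp only [truncMoment, pow_zero, Nat.factorial_zero, Nat.cast_one, div_one, one_mul]
  refine ⟨(intervalIntegrable_iff_integrableOn_Ioc_of_le hq).mpr
    (hh.mono_set Ioc_subset_Ioi_self), ?_⟩
  rw [← intervalIntegral.integral_interval_add_Ioi hh (hh.mono_set (Ioi_subset_Ioi hq))]
  ring

theorem integral_pow_sub_div_factorial (n : ℕ) (w x : ℝ) :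
    ∫ y in (0 : ℝ)..x, (w - y) ^ n / (n ! : ℝ) =
      w ^ (n + 1) / ((n + 1)! : ℝ) - (w - x) ^ (n + 1) / ((n + 1)! : ℝ) := by
  have hn : (n ! : ℝ) ≠ 0 := by positivity
  have h : ∀ y ∈ uIcc 0 x, HasDerivAt (fun y => -((w - y) ^ (n + 1) / ((n + 1)! : ℝ)))
      ((w - y) ^ n / (n ! : ℝ)) y := fun y _ => by
    have h1 : HasDerivAt (fun y => w - y) (-1) y := by
      simpa using (hasDerivAt_id y).const_sub w
    refine ((h1.pow (n + 1)).div_const ((n + 1)! : ℝ)).neg.congr_deriv ?_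
    rw [Nat.factorial_succ]
    push_cast
    field_simp
  rw [intervalIntegral.integral_eq_sub_of_hasDerivAt h
    (Continuous.intervalIntegrable (by fun_prop) _ _)]
  simp
  ring

theorem setIntegral_indicator_pow_sub (n : ℕ) {w q : ℝ} (hw : 0 < w) (hq : 0 ≤ q) :
    ∫ y in Ioc 0 q, (Iio w).indicator (fun y => (w - y) ^ n / (n ! : ℝ)) y =
      w ^ (n + 1) / ((n + 1)! : ℝ) -
        (Ioi q).indicator (fun w => (w - q) ^ (n + 1) / ((n + 1)! : ℝ)) w := by
  rw [setIntegral_indicator measurableSet_Iio]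
  rcases lt_or_ge q w with h | h
  · rw [inter_eq_left.mpr (fun y hy => hy.2.trans_lt h), indicator_of_mem (mem_Ioi.mpr h),
      ← intervalIntegral.integral_of_le hq, integral_pow_sub_div_factorial]
  · have hset : Ioc 0 q ∩ Iio w = Ioo 0 w := by
      ext y
      simp only [mem_inter_iff, mem_Ioc, mem_Iio, mem_Ioo]
      constructor
      · exact fun h' => ⟨h'.1.1, h'.2⟩
      · exact fun h' => ⟨⟨h'.1, h'.2.le.trans h⟩, h'.2⟩
    rw [hset, indicator_of_notMem (by simpa using h), ← integral_Ioc_eq_integral_Ioo,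
      ← intervalIntegral.integral_of_le hw.le, integral_pow_sub_div_factorial]
    simp

theorem truncMoment_eq_setIntegral_indicator (h : ℝ → ℝ) (n : ℕ) {q : ℝ} (hq : 0 ≤ q) :
    truncMoment h n q = ∫ w in Ioi (0 : ℝ),
      (Ioi q).indicator (fun w => (w - q) ^ n / (n ! : ℝ)) w * h w := by
  have : ∀ w, (Ioi q).indicator (fun w => (w - q) ^ n / (n ! : ℝ)) w * h w =
      (Ioi q).indicator (fun w => (w - q) ^ n / (n ! : ℝ) * h w) w := fun w => by
    by_cases hw : w ∈ Ioi q <;> simp [hw]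
  simp only [this]
  rw [setIntegral_indicator measurableSet_Ioi, inter_eq_right.mpr (Ioi_subset_Ioi hq), truncMoment]

/-- This is `Mₙ₊₁' = -Mₙ` in integrated form: by Fubini, integrate the kernel `(w-y)ⁿ/n! · 1_{y<w}`
in `y` over `(0, q]` first. -/
theorem truncMoment_succ_eq_sub {h : ℝ → ℝ} {q : ℝ} (hq : 0 ≤ q) (hmeas : Measurable h)
    (hh : ∀ n : ℕ, IntegrableOn (fun w => w ^ n * h w) (Ioi 0)) (n : ℕ) :
    IntervalIntegrable (truncMoment h n) volume 0 q ∧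
      truncMoment h (n + 1) q = truncMoment h (n + 1) 0 - ∫ y in (0 : ℝ)..q, truncMoment h n y := by
  set k : ℝ → ℝ → ℝ := fun w y => if y < w then (w - y) ^ n / (n ! : ℝ) else 0 with hk
  have hk1 : ∀ w, k w = (Iio w).indicator (fun y => (w - y) ^ n / (n ! : ℝ)) := fun w => by
    ext y
    simp [hk, indicator_apply]
  have hk2 : ∀ y, (fun w => k w y) = (Ioi y).indicator (fun w => (w - y) ^ n / (n ! : ℝ)) :=
    fun y => by
      ext w
      simp [hk, indicator_apply]
  have hkmeas : Measurable fun p : ℝ × ℝ => k p.1 p.2 :=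
    Measurable.ite (measurableSet_lt measurable_snd measurable_fst) (by fun_prop) measurable_const
  have hprod : Integrable (Function.uncurry fun w y : ℝ => k w y * h w)
      ((volume.restrict (Ioi 0)).prod (volume.restrict (Ioc 0 q))) := by
    have hbound : Integrable (fun p : ℝ × ℝ => (p.1 ^ n * h p.1) * (1 / (n ! : ℝ)))
        ((volume.restrict (Ioi 0)).prod (volume.restrict (Ioc 0 q))) :=
      (hh n).mul_prod (integrable_const (μ := volume.restrict (Ioc 0 q)) (1 / (n ! : ℝ)))
    refine hbound.mono (Measurable.aestronglyMeasurable ?_) ?_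
    · exact hkmeas.mul (hmeas.comp measurable_fst)
    · rw [Measure.prod_restrict]
      filter_upwards [ae_restrict_mem (measurableSet_Ioi.prod measurableSet_Ioc)] with p hp
      have hp1 : 0 < p.1 := hp.1
      have hp2 : 0 < p.2 := hp.2.1
      simp only [Function.uncurry, norm_mul, hk]
      split_ifs with hlt
      · have h1 : ‖(p.1 - p.2) ^ n / (n ! : ℝ)‖ ≤ p.1 ^ n * (1 / (n ! : ℝ)) := by
          have h0 : 0 ≤ p.1 - p.2 := by linarith
          rw [Real.norm_of_nonneg (by positivity), div_eq_mul_one_div]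
          gcongr
          linarith
        rw [Real.norm_of_nonneg (show 0 ≤ p.1 ^ n by positivity),
          Real.norm_of_nonneg (show 0 ≤ 1 / (n ! : ℝ) by positivity)]
        calc _ ≤ p.1 ^ n * (1 / (n ! : ℝ)) * ‖h p.1‖ := by gcongr
          _ = _ := by ring
      · simp only [norm_zero, zero_mul]
        positivity
  have hinner : ∀ y ∈ Ioc 0 q, ∫ w in Ioi (0 : ℝ), k w y * h w = truncMoment h n y :=
    fun y hy => by
      rw [truncMoment_eq_setIntegral_indicator h n hy.1.le]
      simp only [← hk2]
  have hswap := integral_integral_swap hprod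
  refine ⟨(intervalIntegrable_iff_integrableOn_Ioc_of_le hq).mpr
    (IntegrableOn.congr_fun hprod.integral_prod_right hinner measurableSet_Ioc), ?_⟩
  rw [setIntegral_congr_fun measurableSet_Ioc hinner, ← intervalIntegral.integral_of_le hq] at hswap
  rw [← hswap, truncMoment_eq_setIntegral_indicator h (n + 1) hq, truncMoment, ← integral_sub]
  · refine setIntegral_congr_fun measurableSet_Ioi fun w (hw : 0 < w) => ?_
    rw [integral_mul_const, hk1, setIntegral_indicator_pow_sub n hw hq, sub_zero]
    ring
  · refine ((hh (n + 1)).div_const ((n + 1)! : ℝ)).congr (Eventually.of_forall fun w => ?_)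
    ring
  · refine hprod.integral_prod_left.congr ?_
    filter_upwards with w
    rfl

/-! ### Coefficients of the double series -/

/-- The Gamma quotient of the first part of the double series. -/
def momentCoeff (α x : ℝ) : ℝ := Real.Gamma ((x + 1) / 2 + α) / Real.Gamma (x / 2 + 1)

/-- The coefficients of the second part of the double series. -/
def residueCoeff (α : ℝ) (N j : ℕ) : ℝ :=
  (-1) ^ (N + 1) / Real.sin (Real.pi * α) *
    (Real.Gamma (j + α + 1 / 2) / ((j ! : ℝ) * Real.Gamma (2 * j + N + 2 * α + 1)))

/-- The denominator sits at a pole of `Γ`. The conventions `Γ = 0` at poles and division by `0`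
equal to `0` give the value `0` that `1/Γ` truly has there. -/
theorem momentCoeff_neg_two_mul_succ (α : ℝ) (i : ℕ) :
    momentCoeff α (-(2 * (i + 1) : ℝ)) = 0 := by
  rw [momentCoeff, show -(2 * (i + 1) : ℝ) / 2 + 1 = -(i : ℝ) by ring,
    Real.Gamma_neg_nat_eq_zero, div_zero]

theorem momentCoeff_sub_two {α x : ℝ} (h : (x - 1) / 2 + α ≠ 0) :
    momentCoeff α (x - 2) = momentCoeff α x * ((x / 2) / ((x - 1) / 2 + α)) := by
  unfold momentCoeff
  rw [show (x + 1) / 2 + α = (x - 1) / 2 + α + 1 by ring, Real.Gamma_add_one h,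
    show (x - 2 + 1) / 2 + α = (x - 1) / 2 + α by ring, show (x - 2) / 2 + 1 = x / 2 by ring]
  rcases eq_or_ne x 0 with rfl | hx
  · simp
  rw [Real.Gamma_add_one (by positivity : x / 2 ≠ 0)]
  rcases eq_or_ne (Real.Gamma (x / 2)) 0 with h0 | h0
  · simp [h0]
  generalize (x - 1) / 2 + α = p at *
  field_simp

theorem exists_abs_momentCoeff_neg_le {α : ℝ} (hα : ∀ m : ℤ, α ≠ m) :
    ∃ B C : ℝ, 1 ≤ B ∧ 0 ≤ C ∧ ∀ m : ℕ, |momentCoeff α (-(m : ℝ))| ≤ C * B ^ m := by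
  obtain ⟨δ, hδ, h⟩ := exists_pos_le_abs_sub_int hα
  -- Stepping from `-(2i+1)` down by two multiplies the coefficient by `1 - (α - 1/2)/(α - (i+1))`,
  -- which `B` bounds uniformly in `i`.
  set B : ℝ := 1 + |α - 1 / 2| / δ with hB
  have hB1 : 1 ≤ B := le_add_of_nonneg_right (by positivity)
  have hodd : ∀ i : ℕ, |momentCoeff α (-(2 * i + 1 : ℝ))| ≤ |momentCoeff α (-1)| * B ^ i := by
    intro i
    induction i with
    | zero => simp
    | succ i ih =>
      have h1 : δ ≤ |α - (i + 1)| := by simpa using h (i + 1 : ℕ)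
      have hne : (-(2 * i + 1 : ℝ) - 1) / 2 + α ≠ 0 := by
        rw [show (-(2 * i + 1 : ℝ) - 1) / 2 + α = α - (i + 1) by ring]
        exact abs_pos.mp (hδ.trans_le h1)
      have hstep := momentCoeff_sub_two hne
      rw [show -(2 * i + 1 : ℝ) - 2 = -(2 * (i + 1 : ℕ) + 1 : ℝ) by push_cast; ring,
        show (-(2 * i + 1 : ℝ) - 1) / 2 + α = α - (i + 1) by ring] at hstep
      rw [hstep, abs_mul, pow_succ, ← mul_assoc]
      refine mul_le_mul ih ?_ (abs_nonneg _) (by positivity)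
      rw [abs_div, div_le_iff₀ (hδ.trans_le h1),
        show -(2 * i + 1 : ℝ) / 2 = (α - (i + 1)) - (α - 1 / 2) by ring]
      refine (abs_sub _ _).trans ?_
      rw [hB, add_mul, one_mul, div_mul_eq_mul_div]
      gcongr
      rw [le_div_iff₀ hδ]
      gcongr
  refine ⟨B, |momentCoeff α 0| + |momentCoeff α (-1)|, hB1, by positivity, fun m => ?_⟩
  have hB0 : 0 ≤ B := zero_le_one.trans hB1
  rcases Nat.even_or_odd' m with ⟨i, rfl | rfl⟩
  · rcases i with _ | i
    · simp
    · rw [show -((2 * (i + 1) : ℕ) : ℝ) = -(2 * (i + 1) : ℝ) by push_cast; ring,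
        momentCoeff_neg_two_mul_succ, abs_zero]
      positivity
  · rw [show -((2 * i + 1 : ℕ) : ℝ) = -(2 * i + 1 : ℝ) by push_cast; ring]
    refine (hodd i).trans (mul_le_mul (by simp) ?_ (by positivity) (by positivity))
    exact pow_le_pow_right₀ hB1 (by omega)

/-- Split by the sign of `n₂ - n₁`. If it is nonnegative, reindexing by `m = n₂ - n₁` gives an
exponential series times the moment series `hs`. If it is negative, the coefficient is at most `C
B^{n₁}`, leaving an exponential times a geometric series. -/
theorem summable_abs_momentTerm {α l : ℝ} (hα : ∀ m : ℤ, α ≠ m) (hl : |l| < 1)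
    (hs : Summable fun m : ℕ => |momentCoeff α m| * |l| ^ m) (q : ℝ) :
    Summable fun n : ℕ × ℕ =>
      |(-1) ^ n.1 / (n.1 ! : ℝ) * momentCoeff α (-(n.1 : ℝ) + n.2) * q ^ n.1 * l ^ n.2| := by
  obtain ⟨B, C, hB, hC, hbd⟩ := exists_abs_momentCoeff_neg_le hα
  have hB0 : 0 ≤ B := zero_le_one.trans hB
  set f : ℕ × ℕ → ℝ := fun n => if n.1 ≤ n.2 then
    |q| ^ n.1 / (n.1 ! : ℝ) * |l| ^ n.2 * |momentCoeff α ((n.2 - n.1 : ℕ) : ℝ)| else 0 with hf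
  have hf_sum : Summable f := by
    have hinj : Function.Injective fun n : ℕ × ℕ => (n.1, n.1 + n.2) := by
      rintro ⟨a, b⟩ ⟨c, d⟩ h
      simp only [Prod.mk.injEq] at h ⊢
      omega
    rw [← hinj.summable_iff]
    · refine (((Real.summable_pow_div_factorial (|q| * |l|)).mul_of_nonneg hs
        (fun _ => by positivity) (fun _ => by positivity))).congr fun n => ?_
      simp only [hf, Function.comp, Nat.le_add_right, if_true, Nat.add_sub_cancel_left, mul_pow,
        pow_add]
      ring
    · rintro ⟨a, b⟩ hab
      simp only [hf]
      refine if_neg fun hle => hab ⟨(a, b - a), ?_⟩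
      simp only [Prod.mk.injEq, true_and]
      omega
  have hg_sum : Summable fun n : ℕ × ℕ => (|q| * B) ^ n.1 / (n.1 ! : ℝ) * (C * |l| ^ n.2) :=
    (Real.summable_pow_div_factorial (|q| * B)).mul_of_nonneg
      ((summable_geometric_of_lt_one (abs_nonneg l) hl).mul_left C)
      (fun _ => by positivity) (fun _ => by positivity)
  refine Summable.of_nonneg_of_le (fun n => abs_nonneg _) (fun n => ?_) (hf_sum.add hg_sum)
  obtain ⟨a, b⟩ := n
  have ha : (0 : ℝ) < a ! := by positivity
  simp only [hf, abs_mul, abs_div, abs_pow, abs_neg, abs_one, one_pow, abs_of_pos ha]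
  split_ifs with hab
  · rw [Nat.cast_sub hab, neg_add_eq_sub]
    have : 0 ≤ (|q| * B) ^ a / (a ! : ℝ) * (C * |l| ^ b) := by positivity
    refine le_add_of_le_of_nonneg (le_of_eq ?_) this
    ring
  · have h1 : |momentCoeff α (-(a : ℝ) + b)| ≤ C * B ^ a := by
      have h2 := hbd (a - b)
      rw [Nat.cast_sub (by omega), neg_sub, sub_eq_neg_add] at h2
      exact h2.trans (mul_le_mul_of_nonneg_left (pow_le_pow_right₀ hB (by omega)) hC)
    rw [zero_add]
    calc 1 / (a ! : ℝ) * |momentCoeff α (-(a : ℝ) + b)| * |q| ^ a * |l| ^ b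
        ≤ 1 / (a ! : ℝ) * (C * B ^ a) * |q| ^ a * |l| ^ b := by gcongr
      _ = _ := by rw [mul_pow]; ring

theorem Gamma_mul_factorial_le {x : ℝ} (hx : 0 ≤ x) (n : ℕ) :
    Real.Gamma (x + 1) * n ! ≤ Real.Gamma (x + n + 1) := by
  induction n with
  | zero => simp
  | succ n ih =>
    have h1 : x + ((n + 1 : ℕ) : ℝ) ≠ 0 := by positivity
    have h2 := Real.Gamma_pos_of_pos (show 0 < x + 1 by positivity)
    rw [Real.Gamma_add_one h1, Nat.factorial_succ]
    have h3 : x + ((n + 1 : ℕ) : ℝ) = x + n + 1 := by push_cast; ring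
    rw [h3]
    calc Real.Gamma (x + 1) * ((n + 1) * n ! : ℕ)
        = (n + 1) * (Real.Gamma (x + 1) * n !) := by push_cast; ring
      _ ≤ (x + n + 1) * Real.Gamma (x + n + 1) := by
        refine mul_le_mul (by linarith) ih (by positivity) (by positivity)

theorem Gamma_div_Gamma_two_mul_le {a : ℝ} (ha : 0 < a) (j : ℕ) :
    Real.Gamma (j + a) / Real.Gamma (2 * j + 2 * a + 1) ≤
      Real.Gamma a / Real.Gamma (2 * a + 1) := by
  induction j with
  | zero => simp
  | succ j ih =>
    refine le_trans ?_ ih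
    have h1 : 0 < (j : ℝ) + a := by positivity
    have h2 : 0 < 2 * (j : ℝ) + 2 * a + 1 := by positivity
    have g1 := Real.Gamma_pos_of_pos h1
    have g2 := Real.Gamma_pos_of_pos h2
    rw [show ((j + 1 : ℕ) : ℝ) + a = (j + a) + 1 by push_cast; ring,
      show 2 * ((j + 1 : ℕ) : ℝ) + 2 * a + 1 = (2 * j + 2 * a + 1) + 1 + 1 by push_cast; ring,
      Real.Gamma_add_one h1.ne', Real.Gamma_add_one (by positivity),
      Real.Gamma_add_one h2.ne', div_le_div_iff₀ (by positivity) (by positivity)]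
    have h3 : (j : ℝ) + a ≤ (2 * j + 2 * a + 1 + 1) * (2 * j + 2 * a + 1) := by nlinarith
    calc (j + a) * Real.Gamma (j + a) * Real.Gamma (2 * j + 2 * a + 1)
        = (j + a) * (Real.Gamma (j + a) * Real.Gamma (2 * j + 2 * a + 1)) := by ring
      _ ≤ (2 * j + 2 * a + 1 + 1) * (2 * j + 2 * a + 1) *
          (Real.Gamma (j + a) * Real.Gamma (2 * j + 2 * a + 1)) := by gcongr
      _ = _ := by ring

theorem sin_pi_mul_ne_zero {α : ℝ} (hα : ∀ m : ℤ, α ≠ m) : Real.sin (Real.pi * α) ≠ 0 := by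
  rw [Ne, Real.sin_eq_zero_iff]
  rintro ⟨m, hm⟩
  exact hα m (mul_left_cancel₀ Real.pi_ne_zero (by linarith))

theorem summable_abs_residueTerm {α l q : ℝ} (hα0 : -(1 / 2) < α) (hα : ∀ m : ℤ, α ≠ m)
    (hl : |l| ≤ 1) (hq : 0 ≤ q) :
    Summable fun n : ℕ × ℕ =>
      |residueCoeff α (n.2 + 1) n.1 * q ^ (2 * (n.1 : ℝ) + (n.2 + 1 : ℕ) + 2 * α) * l ^ n.2| := by
  set a := α + 1 / 2 with ha
  have ha0 : 0 < a := by linarith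
  set c := |Real.sin (Real.pi * α)|
  have hc : 0 < c := abs_pos.mpr (sin_pi_mul_ne_zero hα)
  set ρ := Real.Gamma a / Real.Gamma (2 * a + 1)
  have hs : Summable fun n : ℕ × ℕ =>
      (q ^ 2) ^ n.1 / (n.1 ! : ℝ) * (c⁻¹ * ρ * q ^ (2 * a) * (q ^ n.2 / (n.2 ! : ℝ))) := by
    have g1 := Real.Gamma_pos_of_pos ha0
    have g2 := Real.Gamma_pos_of_pos (show 0 < 2 * a + 1 by positivity)
    exact (Real.summable_pow_div_factorial (q ^ 2)).mul_of_nonneg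
      ((Real.summable_pow_div_factorial q).mul_left _)
      (fun _ => by positivity) (fun _ => by positivity)
  refine Summable.of_nonneg_of_le (fun n => abs_nonneg _) (fun n => ?_) hs
  obtain ⟨j, n⟩ := n
  have g1 := Real.Gamma_pos_of_pos (show 0 < (j : ℝ) + a by positivity)
  have g2 := Real.Gamma_pos_of_pos (show 0 < 2 * (j : ℝ) + 2 * a + 1 by positivity)
  have g3 := Real.Gamma_pos_of_pos (show 0 < 2 * (j : ℝ) + 2 * a + n + 1 by positivity)
  have hj : (0 : ℝ) < j ! := by positivity
  have hn : (0 : ℝ) < n ! := by positivity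
  have hpow : q ^ (2 * (j : ℝ) + (n + 1 : ℕ) + 2 * α) = (q ^ 2) ^ j * q ^ n * q ^ (2 * a) := by
    rw [show 2 * (j : ℝ) + (n + 1 : ℕ) + 2 * α = ((2 * j + n : ℕ) : ℝ) + 2 * a by
      push_cast; ring, Real.rpow_add_of_nonneg hq (by positivity) (by positivity),
      Real.rpow_natCast, pow_add, pow_mul]
  -- The denominator `Γ(2j+2a+n+1)` supplies an `n!`, and the remaining quotient does not increase
  -- with `j`, hence is at most its value `ρ` at `j = 0`. The bound is a product of two exponential
  -- series.
  have hcoeff : |residueCoeff α (n + 1) j| ≤ c⁻¹ * (ρ / ((j ! : ℝ) * n !)) := by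
    rw [residueCoeff, abs_mul, abs_div, abs_pow, abs_neg, abs_one, one_pow, one_div]
    rw [show (j : ℝ) + α + 1 / 2 = j + a by ring,
      show 2 * (j : ℝ) + (n + 1 : ℕ) + 2 * α + 1 = 2 * j + 2 * a + n + 1 by push_cast; ring,
      abs_of_pos (show 0 < Real.Gamma (j + a) /
        ((j ! : ℝ) * Real.Gamma (2 * j + 2 * a + n + 1)) by positivity)]
    refine mul_le_mul_of_nonneg_left ?_ (inv_nonneg.mpr hc.le)
    calc Real.Gamma (j + a) / ((j ! : ℝ) * Real.Gamma (2 * j + 2 * a + n + 1))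
        ≤ Real.Gamma (j + a) / ((j ! : ℝ) * (Real.Gamma (2 * j + 2 * a + 1) * n !)) := by
          gcongr
          exact Gamma_mul_factorial_le (by positivity) n
      _ = Real.Gamma (j + a) / Real.Gamma (2 * j + 2 * a + 1) / ((j ! : ℝ) * n !) := by
          field_simp
      _ ≤ _ := by
          gcongr
          exact Gamma_div_Gamma_two_mul_le ha0 j
  simp only
  rw [hpow, abs_mul, abs_mul, abs_of_nonneg (show 0 ≤ (q ^ 2) ^ j * q ^ n * q ^ (2 * a) by
    positivity), abs_pow]
  calc |residueCoeff α (n + 1) j| * ((q ^ 2) ^ j * q ^ n * q ^ (2 * a)) * |l| ^ n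
      ≤ c⁻¹ * (ρ / ((j ! : ℝ) * n !)) * ((q ^ 2) ^ j * q ^ n * q ^ (2 * a)) * 1 := by
        gcongr
        exact pow_le_one₀ (abs_nonneg l) hl
    _ = _ := by ring

/-! ### Series of the density -/

theorem Gamma_half_sub_nat (i : ℕ) :
    Real.Gamma (1 / 2 - i) * ((2 * i)! : ℝ) = √Real.pi * (-4) ^ i * i ! := by
  induction i with
  | zero => simpa using Real.Gamma_one_half_eq
  | succ i ih =>
    have hne : (1 : ℝ) / 2 - (i + 1 : ℕ) ≠ 0 := by
      push_cast
      have : (0 : ℝ) ≤ i := i.cast_nonneg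
      linarith
    have h1 := Real.Gamma_add_one hne
    rw [show (1 : ℝ) / 2 - (i + 1 : ℕ) + 1 = 1 / 2 - i by push_cast; ring] at h1
    rw [h1] at ih
    rw [show 2 * (i + 1) = 2 * i + 1 + 1 by ring, Nat.factorial_succ, Nat.factorial_succ,
      Nat.factorial_succ, pow_succ]
    push_cast at ih ⊢
    linear_combination (-4 * ((i : ℝ) + 1)) * ih

/-- At level `N = 0` the arguments `-1 - j` are negative: odd `j` gives a zero of `1/Γ`, and even
`j` gives the even power series of the Bessel function. -/
theorem hasSum_momentCoeff_zero {α : ℝ} (hα : ∀ m : ℤ, α ≠ m) (q : ℝ) :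
    HasSum (fun j : ℕ => (-1) ^ j / (j ! : ℝ) * momentCoeff α (((0 : ℕ) : ℝ) - 1 - j) * q ^ j)
      (besselPowerSeries α (q ^ 2 / 4) / √Real.pi) := by
  have hpi : 0 < √Real.pi := Real.sqrt_pos.mpr Real.pi_pos
  rw [← add_zero (besselPowerSeries α (q ^ 2 / 4) / √Real.pi)]
  refine HasSum.even_add_odd ?_ ?_
  · refine ((hasSum_besselPowerSeries hα (q ^ 2 / 4)).div_const (√Real.pi)).congr_fun fun i => ?_
    have h := Gamma_half_sub_nat i
    have h2 : (0 : ℝ) < (2 * i)! := by positivity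
    have hi : (0 : ℝ) < i ! := by positivity
    have hG : Real.Gamma (1 / 2 - i) ≠ 0 := by
      intro h0
      rw [h0, zero_mul] at h
      have : √Real.pi * (-4) ^ i * i ! ≠ 0 := by positivity
      exact this h.symm
    have h44 : (-4 : ℝ) ^ i = (-1) ^ i * 4 ^ i := by rw [← mul_pow]; norm_num
    have h11 : (-1 : ℝ) ^ i * (-1) ^ i = 1 := by rw [← mul_pow]; norm_num
    rw [momentCoeff, besselCoeff, show (((0 : ℕ) : ℝ) - 1 - (2 * i : ℕ) + 1) / 2 + α = α - i by
      push_cast; ring, show (((0 : ℕ) : ℝ) - 1 - (2 * i : ℕ)) / 2 + 1 = 1 / 2 - i by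
      push_cast; ring, pow_mul, pow_mul, neg_one_sq, one_pow, div_pow]
    rw [h44] at h
    generalize Real.Gamma (1 / 2 - i) = G at *
    field_simp
    linear_combination Real.Gamma (α - i) * (q ^ 2) ^ i *
      ((-(-1) ^ i) * h - (√Real.pi * 4 ^ i * i !) * h11)
  · refine hasSum_zero.congr_fun fun i => ?_
    rw [show ((0 : ℕ) : ℝ) - 1 - (2 * i + 1 : ℕ) = -(2 * (i + 1) : ℝ) by push_cast; ring,
      momentCoeff_neg_two_mul_succ]
    ring

theorem sin_pi_mul_neg_sub_nat (α : ℝ) (j : ℕ) :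
    Real.sin (Real.pi * (-α - j)) = -((-1) ^ j * Real.sin (Real.pi * α)) := by
  rw [show Real.pi * (-α - j) = -(Real.pi * α + j * Real.pi) by ring, Real.sin_neg,
    Real.sin_add_nat_mul_pi]

/-- Reflection trades `Γ(-α-j)` for `sin(πα)` and `Γ(j+α+1)`; duplication then combines the latter
with `Γ(j+α+1/2)`. -/
theorem residueCoeff_zero_mul_rpow {α q : ℝ} (hα0 : -(1 / 2) < α) (hα : ∀ m : ℤ, α ≠ m)
    (hq : 0 < q) (j : ℕ) :
    residueCoeff α 0 j * q ^ (2 * (j : ℝ) + ((0 : ℕ) : ℝ) + 2 * α) =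
      (q ^ 2 / 4) ^ α * (besselCoeff (-α) j * (q ^ 2 / 4) ^ j) / √Real.pi := by
  have hj0 : (0 : ℝ) ≤ j := j.cast_nonneg
  have hpi : 0 < √Real.pi := Real.sqrt_pos.mpr Real.pi_pos
  have hsin := sin_pi_mul_ne_zero hα
  have g1 := Real.Gamma_pos_of_pos (show 0 < (j : ℝ) + α + 1 by linarith)
  have g2 := Real.Gamma_pos_of_pos (show 0 < 2 * (j : ℝ) + 2 * α + 1 by linarith)
  have hrefl := Real.Gamma_mul_Gamma_one_sub (-α - j)
  rw [sin_pi_mul_neg_sub_nat, show 1 - (-α - (j : ℝ)) = j + α + 1 by ring] at hrefl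
  have hdup := Real.Gamma_mul_Gamma_add_half (j + α + 1 / 2)
  rw [show (j : ℝ) + α + 1 / 2 + 1 / 2 = j + α + 1 by ring,
    show 2 * ((j : ℝ) + α + 1 / 2) = 2 * j + 2 * α + 1 by ring,
    show 1 - (2 * (j : ℝ) + 2 * α + 1) = -(2 * (α + j)) by ring, Real.rpow_neg (by norm_num),
    Real.rpow_mul (by norm_num), show (2 : ℝ) ^ (2 : ℝ) = 4 by norm_num] at hdup
  have hpow : q ^ (2 * (j : ℝ) + ((0 : ℕ) : ℝ) + 2 * α) = (q ^ 2) ^ (α + j) := by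
    rw [← Real.rpow_natCast q 2, ← Real.rpow_mul hq.le]
    congr 1
    push_cast
    ring
  have hpow2 : (q ^ 2 / 4) ^ α * (q ^ 2 / 4) ^ j = (q ^ 2) ^ (α + j) / 4 ^ (α + j) := by
    rw [← Real.rpow_natCast (q ^ 2 / 4) j, ← Real.rpow_add (by positivity), Real.div_rpow (by positivity)
      (by norm_num)]
  have h11 : (-1 : ℝ) ^ j * (-1) ^ j = 1 := by rw [← mul_pow]; norm_num
  have hm1 : (-1 : ℝ) ^ j ≠ 0 := by positivity
  have hG : Real.Gamma (-α - j) = -((-1) ^ j * Real.pi) /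
      (Real.sin (Real.pi * α) * Real.Gamma (j + α + 1)) := by
    rw [eq_div_iff (by positivity)]
    rw [eq_div_iff (by simpa using hsin)] at hrefl
    linear_combination (-(-1) ^ j) * hrefl -
      (Real.Gamma (-α - j) * Real.Gamma (j + α + 1) * Real.sin (Real.pi * α)) * h11
  have h4 : (0 : ℝ) < 4 ^ (α + j) := by positivity
  have hH : Real.Gamma (j + α + 1 / 2) =
      Real.Gamma (2 * j + 2 * α + 1) * (4 ^ (α + j))⁻¹ * √Real.pi / Real.Gamma (j + α + 1) := by
    rw [eq_div_iff g1.ne', hdup]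
  rw [show (q ^ 2 / 4) ^ α * (besselCoeff (-α) j * (q ^ 2 / 4) ^ j) =
    besselCoeff (-α) j * ((q ^ 2 / 4) ^ α * (q ^ 2 / 4) ^ j) by ring, hpow2, hpow, residueCoeff,
    besselCoeff, hG, hH,
    show 2 * (j : ℝ) + ((0 : ℕ) : ℝ) + 2 * α + 1 = 2 * j + 2 * α + 1 by push_cast; ring]
  have hj : (0 : ℝ) < j ! := by positivity
  have hsq : √Real.pi * √Real.pi = Real.pi := Real.mul_self_sqrt Real.pi_pos.le
  generalize Real.Gamma (2 * (j : ℝ) + 2 * α + 1) = G₁ at *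
  generalize Real.Gamma ((j : ℝ) + α + 1) = G₂ at *
  generalize (4 : ℝ) ^ (α + (j : ℝ)) = P at *
  generalize (q ^ 2) ^ (α + (j : ℝ)) = R at *
  generalize Real.sin (Real.pi * α) = σ at *
  generalize √Real.pi = S at *
  generalize Real.pi = p at *
  subst hsq
  field_simp
  simp only [zero_add, pow_one]
  linear_combination R * h11

/-- The first part of the series of the `N`-fold iterated tail integral of the density. -/
def momentSum (α : ℝ) (N : ℕ) (q : ℝ) : ℝ :=
  ∑' j : ℕ, (-1) ^ j / (j ! : ℝ) * momentCoeff α ((N : ℝ) - 1 - j) * q ^ j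

/-- The second part of the series of the `N`-fold iterated tail integral of the density. -/
def residueSum (α : ℝ) (N : ℕ) (q : ℝ) : ℝ :=
  ∑' j : ℕ, residueCoeff α N j * q ^ (2 * (j : ℝ) + N + 2 * α)

/-- Termwise integration shifts `j` and `N` together and so keeps the argument `N - 1 - j`. The new
term `j = 0` is the constant of integration. -/
theorem momentSum_succ_eq_sub {α x : ℝ} (N : ℕ) (hx : 0 ≤ x)
    (hN : ∀ y ∈ Ioc 0 x, Summable fun j : ℕ =>
      (-1) ^ j / (j ! : ℝ) * momentCoeff α ((N : ℝ) - 1 - j) * y ^ j)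
    (hs : Summable fun j : ℕ =>
      |(-1) ^ j / (j ! : ℝ) * momentCoeff α (((N + 1 : ℕ) : ℝ) - 1 - j) * x ^ j|) :
    IntervalIntegrable (momentSum α N) volume 0 x ∧
      momentSum α (N + 1) x = momentCoeff α N - ∫ y in (0 : ℝ)..x, momentSum α N y := by
  obtain ⟨h1, h2⟩ := hasSum_integral_rpow (x := x) (f := fun y => -momentSum α N y)
    (b := fun j : ℕ => (-1) ^ (j + 1) / ((j + 1)! : ℝ) *
      momentCoeff α (((N + 1 : ℕ) : ℝ) - 1 - (j + 1 : ℕ)))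
    (e := fun j => (j : ℝ) + 1) hx (fun j => by positivity)
    (((summable_nat_add_iff 1).mpr hs).congr fun j => by
      rw [abs_mul _ (x ^ (j + 1)), abs_of_nonneg (pow_nonneg hx _), ← Nat.cast_succ,
        Real.rpow_natCast])
    (fun y hy => by
      refine (hN y hy).hasSum.neg.congr_fun fun j => ?_
      have hj : (j ! : ℝ) ≠ 0 := by positivity
      rw [add_sub_cancel_right, Real.rpow_natCast, Nat.factorial_succ, pow_succ,
        show ((N + 1 : ℕ) : ℝ) - 1 - (j + 1 : ℕ) = (N : ℝ) - 1 - j by push_cast; ring]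
      push_cast
      field_simp)
  refine ⟨by simpa [Pi.neg_def] using h1.neg, ?_⟩
  rw [intervalIntegral.integral_neg] at h2
  have h3 : HasSum (fun j : ℕ => (-1) ^ (j + 1) / ((j + 1)! : ℝ) *
      momentCoeff α (((N + 1 : ℕ) : ℝ) - 1 - (j + 1 : ℕ)) * x ^ (j + 1))
      (-∫ y in (0 : ℝ)..x, momentSum α N y) := by
    refine h2.congr_fun fun j => ?_
    rw [← Nat.cast_succ, Real.rpow_natCast]
  rw [momentSum, hs.of_abs.tsum_eq_zero_add, h3.tsum_eq]
  simp
  ring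

theorem residueCoeff_succ_mul {α : ℝ} (N j : ℕ) (h : 2 * (j : ℝ) + (N + 1 : ℕ) + 2 * α ≠ 0) :
    residueCoeff α (N + 1) j * (2 * (j : ℝ) + (N + 1 : ℕ) + 2 * α) = -residueCoeff α N j := by
  rw [residueCoeff, residueCoeff, Real.Gamma_add_one h,
    show 2 * (j : ℝ) + N + 2 * α + 1 = 2 * (j : ℝ) + (N + 1 : ℕ) + 2 * α by push_cast; ring,
    pow_succ (-1 : ℝ) (N + 1), show ∀ s t u G F : ℝ, s * -1 / t * (G / (F * (u * Real.Gamma u))) *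
      u = -(s / t * (G / (F * Real.Gamma u))) * (u / u) by intros; field_simp]
  rw [div_self h, mul_one]

theorem residueSum_succ_eq {α x : ℝ} (hα0 : -(1 / 2) < α) (N : ℕ) (hx : 0 ≤ x)
    (hN : ∀ y ∈ Ioc 0 x, Summable fun j : ℕ => residueCoeff α N j * y ^ (2 * (j : ℝ) + N + 2 * α))
    (hs : Summable fun j : ℕ =>
      |residueCoeff α (N + 1) j * x ^ (2 * (j : ℝ) + (N + 1 : ℕ) + 2 * α)|) :
    IntervalIntegrable (residueSum α N) volume 0 x ∧
      residueSum α (N + 1) x = -∫ y in (0 : ℝ)..x, residueSum α N y := by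
  -- Positivity, which rests on `2α > -1`, makes every power vanish at `0`, so this family gets no
  -- constant of integration.
  have he : ∀ j : ℕ, 0 < 2 * (j : ℝ) + (N + 1 : ℕ) + 2 * α := fun j => by
    push_cast
    linarith [show (0 : ℝ) ≤ j from j.cast_nonneg, show (0 : ℝ) ≤ N from N.cast_nonneg]
  obtain ⟨h1, h2⟩ := hasSum_integral_rpow (x := x) (f := fun y => -residueSum α N y)
    (b := fun j : ℕ => residueCoeff α (N + 1) j)
    (e := fun j => 2 * (j : ℝ) + (N + 1 : ℕ) + 2 * α) hx he
    (hs.congr fun j => by rw [abs_mul, abs_of_nonneg (Real.rpow_nonneg hx _)])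
    (fun y hy => by
      refine (hN y hy).hasSum.neg.congr_fun fun j => ?_
      rw [← mul_assoc, residueCoeff_succ_mul N j (he j).ne',
        show 2 * (j : ℝ) + (N + 1 : ℕ) + 2 * α - 1 = 2 * (j : ℝ) + N + 2 * α by push_cast; ring,
        neg_mul])
  refine ⟨by simpa [Pi.neg_def] using h1.neg, ?_⟩
  rw [residueSum, h2.tsum_eq, intervalIntegral.integral_neg]

/-! ### Truncated moments of the density -/

theorem two_mul_Gamma_mul_truncMoment_zero {α : ℝ} (hα0 : -(1 / 2) < α) (n : ℕ) :
    2 * Real.Gamma (α + 1 / 2) * truncMoment (symmetricDensity (α + 1 / 2)) n 0 =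
      momentCoeff α n := by
  have ha : 0 < α + 1 / 2 := by linarith
  have hG := Real.Gamma_pos_of_pos ha
  have hn : (0 : ℝ) < n ! := by positivity
  have h : truncMoment (symmetricDensity (α + 1 / 2)) n 0 =
      (1 / (n ! : ℝ)) * ∫ v in Ioi (0 : ℝ), v ^ n * symmetricDensity (α + 1 / 2) v := by
    rw [truncMoment, ← integral_const_mul]
    congr 1 with v
    rw [sub_zero]
    ring
  rw [h, (integral_pow_mul_symmetricDensity ha n).2, momentCoeff,
    show ((n : ℝ) + 1) / 2 + α = α + 1 / 2 + n / 2 by ring]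
  generalize Real.Gamma (α + 1 / 2) = G at *
  field_simp

theorem integrableOn_exp_mul_symmetricDensity {a l q : ℝ} (ha : 0 < a) (hl : |l| < 1) :
    IntegrableOn (fun w => Real.exp (l * (w - q)) * symmetricDensity a w) (Ioi q) := by
  refine (((integral_exp_mul_symmetricDensity ha hl).1.const_mul (Real.exp (-(l * q)))).congr
    (Eventually.of_forall fun w => ?_)).integrableOn
  simp only
  rw [← mul_assoc, ← Real.exp_add]
  congr 2
  ring

/-- The absolute terms of the exponential series add up to `e^{|l|(w-q)} h(w)`, which is integrable
because `|l| < 1`; dominated convergence applies. -/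
theorem hasSum_pow_mul_truncMoment {a l : ℝ} (ha : 0 < a) (hl : |l| < 1) (q : ℝ) :
    HasSum (fun n : ℕ => l ^ n * truncMoment (symmetricDensity a) n q)
      (∫ w in Ioi q, Real.exp (l * (w - q)) * symmetricDensity a w) := by
  have hexp : ∀ c x : ℝ, HasSum (fun n : ℕ => c ^ n * (x ^ n / (n ! : ℝ))) (Real.exp (c * x)) :=
    fun c x => by
      have h := NormedSpace.expSeries_div_hasSum_exp (c * x)
      rw [← Real.exp_eq_exp_ℝ] at h
      refine h.congr_fun fun n => ?_
      rw [mul_pow]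
      ring
  have hbd : ∀ w, HasSum (fun n : ℕ => |l| ^ n * ((w - q) ^ n / (n ! : ℝ) * symmetricDensity a w))
      (Real.exp (|l| * (w - q)) * symmetricDensity a w) := fun w =>
    ((hexp |l| (w - q)).mul_right (symmetricDensity a w)).congr_fun fun n => by ring
  have key := hasSum_integral_of_dominated_convergence (μ := volume.restrict (Ioi q))
    (F := fun n w => l ^ n * ((w - q) ^ n / (n ! : ℝ) * symmetricDensity a w))
    (f := fun w => Real.exp (l * (w - q)) * symmetricDensity a w)
    (fun n w => |l| ^ n * ((w - q) ^ n / (n ! : ℝ) * symmetricDensity a w))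
    (fun n => by
      have := measurable_symmetricDensity a
      fun_prop)
    (fun n => by
      filter_upwards [ae_restrict_mem measurableSet_Ioi] with w (hw : q < w)
      have h1 : 0 ≤ w - q := by linarith
      have h2 := symmetricDensity_nonneg ha w
      rw [norm_mul, norm_pow, Real.norm_eq_abs, Real.norm_of_nonneg (by positivity)])
    (Eventually.of_forall fun w => (hbd w).summable)
    (by
      simp only [fun w => (hbd w).tsum_eq]
      exact integrableOn_exp_mul_symmetricDensity ha (by rwa [abs_abs]))
    (Eventually.of_forall fun w =>
      ((hexp l (w - q)).mul_right (symmetricDensity a w)).congr_fun fun n => by ring)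
  refine key.congr_fun fun n => ?_
  rw [integral_const_mul, truncMoment]

theorem momentCoeff_nonneg {α : ℝ} (hα0 : -(1 / 2) < α) (m : ℕ) : 0 ≤ momentCoeff α m := by
  have hm : (0 : ℝ) ≤ m := m.cast_nonneg
  exact div_nonneg (Real.Gamma_pos_of_pos (by linarith)).le (Real.Gamma_pos_of_pos (by linarith)).le

/-- No Gamma asymptotics are needed: up to a constant these are the moments `Mₘ(0)`, so convergence
is the expansion at `q = 0`. -/
theorem summable_abs_momentCoeff {α l : ℝ} (hα0 : -(1 / 2) < α) (hl : |l| < 1) :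
    Summable fun m : ℕ => |momentCoeff α m| * |l| ^ m := by
  have h := ((hasSum_pow_mul_truncMoment (a := α + 1 / 2) (by linarith)
    (by rwa [abs_abs] : |(|l|)| < 1) 0).summable.mul_left (2 * Real.Gamma (α + 1 / 2)))
  refine h.congr fun m => ?_
  rw [abs_of_nonneg (momentCoeff_nonneg hα0 m), ← two_mul_Gamma_mul_truncMoment_zero hα0]
  ring

theorem summable_abs_momentSum_succ {α : ℝ} (hα0 : -(1 / 2) < α) (hα : ∀ m : ℤ, α ≠ m) (n : ℕ)
    (q : ℝ) : Summable fun j : ℕ =>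
      |(-1) ^ j / (j ! : ℝ) * momentCoeff α (((n + 1 : ℕ) : ℝ) - 1 - j) * q ^ j| := by
  -- A single row of the double series is wanted; any nonzero `l` with `|l| < 1` would do, its power
  -- being divided out afterwards.
  have hl : |(1 / 2 : ℝ)| < 1 := by rw [abs_of_pos] <;> norm_num
  have h := (summable_abs_momentTerm hα hl (summable_abs_momentCoeff hα0 hl) q).comp_injective
    (i := fun j : ℕ => (j, n)) fun a b hab => (Prod.mk.inj hab).1
  refine (h.mul_left (2 ^ n)).congr fun j => ?_
  simp only [Function.comp]
  rw [abs_mul _ ((1 / 2 : ℝ) ^ n), abs_of_pos (show (0 : ℝ) < (1 / 2) ^ n by positivity),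
    show ((n + 1 : ℕ) : ℝ) - 1 - j = -(j : ℝ) + n by push_cast; ring, one_div, inv_pow]
  field_simp

theorem summable_abs_residueSum_succ {α q : ℝ} (hα0 : -(1 / 2) < α) (hα : ∀ m : ℤ, α ≠ m) (n : ℕ)
    (hq : 0 ≤ q) : Summable fun j : ℕ =>
      |residueCoeff α (n + 1) j * q ^ (2 * (j : ℝ) + (n + 1 : ℕ) + 2 * α)| := by
  have h := (summable_abs_residueTerm (l := 1) hα0 hα (by simp) hq).comp_injective
    (i := fun j : ℕ => (j, n)) fun a b hab => (Prod.mk.inj hab).1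
  refine h.congr fun j => ?_
  simp only [Function.comp, one_pow, mul_one]

theorem hasSum_residueCoeff_zero {α q : ℝ} (hα0 : -(1 / 2) < α) (hα : ∀ m : ℤ, α ≠ m)
    (hq : 0 < q) :
    HasSum (fun j : ℕ => residueCoeff α 0 j * q ^ (2 * (j : ℝ) + ((0 : ℕ) : ℝ) + 2 * α))
      ((q ^ 2 / 4) ^ α * besselPowerSeries (-α) (q ^ 2 / 4) / √Real.pi) :=
  (((hasSum_besselPowerSeries (not_int_neg hα) (q ^ 2 / 4)).mul_left
    ((q ^ 2 / 4) ^ α)).div_const (√Real.pi)).congr_fun fun j =>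
      residueCoeff_zero_mul_rpow hα0 hα hq j

theorem two_mul_Gamma_mul_symmetricDensity {α q : ℝ} (hα0 : -(1 / 2) < α) (hα : ∀ m : ℤ, α ≠ m)
    (hq : 0 < q) :
    2 * Real.Gamma (α + 1 / 2) * symmetricDensity (α + 1 / 2) q =
      momentSum α 0 q + residueSum α 0 q := by
  have hG := Real.Gamma_pos_of_pos (show 0 < α + 1 / 2 by linarith)
  have hpi : 0 < √Real.pi := Real.sqrt_pos.mpr Real.pi_pos
  rw [momentSum, residueSum, (hasSum_momentCoeff_zero hα q).tsum_eq,
    (hasSum_residueCoeff_zero hα0 hα hq).tsum_eq, symmetricDensity, add_sub_cancel_right,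
    besselIntegral_eq_besselSeries (by linarith) hα (by positivity), besselSeries]
  generalize Real.Gamma (α + 1 / 2) = G at *
  field_simp

/-- The series of the truncated moments of the density. -/
theorem two_mul_Gamma_mul_truncMoment {α q : ℝ} (hα0 : -(1 / 2) < α) (hα : ∀ m : ℤ, α ≠ m)
    (hq : 0 ≤ q) (n : ℕ) :
    2 * Real.Gamma (α + 1 / 2) * truncMoment (symmetricDensity (α + 1 / 2)) n q =
      momentSum α (n + 1) q + residueSum α (n + 1) q := by
  have ha : 0 < α + 1 / 2 := by linarith
  have hpow : ∀ n : ℕ, IntegrableOn (fun w => w ^ n * symmetricDensity (α + 1 / 2) w) (Ioi 0) :=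
    fun n => (integral_pow_mul_symmetricDensity ha n).1
  have hA : ∀ {q : ℝ}, 0 ≤ q → ∀ N : ℕ, IntervalIntegrable (momentSum α N) volume 0 q ∧
      momentSum α (N + 1) q = momentCoeff α N - ∫ y in (0 : ℝ)..q, momentSum α N y := fun hq N => by
    refine momentSum_succ_eq_sub N hq (fun y hy => ?_) (summable_abs_momentSum_succ hα0 hα N _)
    -- Level `N` corresponds to the row `n = N - 1` of the double series, so `N = 0`, the density
    -- itself, needs its own convergence proof.
    rcases N with _ | N
    · exact (hasSum_momentCoeff_zero hα y).summable
    · exact (summable_abs_momentSum_succ hα0 hα N y).of_abs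
  have hD : ∀ {q : ℝ}, 0 ≤ q → ∀ N : ℕ, IntervalIntegrable (residueSum α N) volume 0 q ∧
      residueSum α (N + 1) q = -∫ y in (0 : ℝ)..q, residueSum α N y := fun hq N => by
    refine residueSum_succ_eq hα0 N hq (fun y hy => ?_) (summable_abs_residueSum_succ hα0 hα N hq)
    rcases N with _ | N
    · exact (hasSum_residueCoeff_zero hα0 hα hy.1).summable
    · exact (summable_abs_residueSum_succ hα0 hα N hy.1.le).of_abs
  have hstep : ∀ {q : ℝ}, 0 ≤ q → ∀ (N : ℕ) (J : ℝ → ℝ),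
      (∀ y ∈ Ioc 0 q, 2 * Real.Gamma (α + 1 / 2) * J y = momentSum α N y + residueSum α N y) →
      2 * Real.Gamma (α + 1 / 2) * ∫ y in (0 : ℝ)..q, J y =
        momentCoeff α N - (momentSum α (N + 1) q + residueSum α (N + 1) q) := fun hq N J hJ => by
    rw [(hA hq N).2, (hD hq N).2, ← intervalIntegral.integral_const_mul]
    have h := intervalIntegral.integral_add (hA hq N).1 (hD hq N).1
    rw [intervalIntegral.integral_of_le hq, setIntegral_congr_fun measurableSet_Ioc hJ,
      ← intervalIntegral.integral_of_le hq, h]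
    ring
  induction n generalizing q with
  | zero =>
    have h0 := (truncMoment_zero_eq_sub hq (h := symmetricDensity (α + 1 / 2))
      (by simpa using hpow 0)).2
    have h1 := hstep hq 0 _ fun y hy => two_mul_Gamma_mul_symmetricDensity hα0 hα hy.1
    have h2 := two_mul_Gamma_mul_truncMoment_zero hα0 0
    rw [h0]
    linarith
  | succ n ih =>
    have h0 := (truncMoment_succ_eq_sub hq (measurable_symmetricDensity (α + 1 / 2)) hpow n).2
    have h1 := hstep hq (n + 1) (truncMoment (symmetricDensity (α + 1 / 2)) n) fun y hy =>
      ih hy.1.le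
    have h2 := two_mul_Gamma_mul_truncMoment_zero hα0 (n + 1)
    rw [h0]
    linarith

/-- The term of index `n` of the double series in the standard case. -/
def standardTerm (α l q : ℝ) (n : ℕ × ℕ) : ℝ :=
  (-1) ^ n.1 / (n.1 ! : ℝ) * momentCoeff α (-(n.1 : ℝ) + n.2) * q ^ n.1 * l ^ n.2 +
    residueCoeff α (n.2 + 1) n.1 * q ^ (2 * (n.1 : ℝ) + (n.2 + 1 : ℕ) + 2 * α) * l ^ n.2

/-- The exponential integral of the density over a half line as a double series. -/
theorem hasSum_standardTerm {α l q : ℝ} (hα0 : -(1 / 2) < α) (hα : ∀ m : ℤ, α ≠ m)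
    (hl : |l| < 1) (hq : 0 ≤ q) :
    HasSum (standardTerm α l q) (2 * Real.Gamma (α + 1 / 2) *
      ∫ w in Ioi q, Real.exp (l * (w - q)) * symmetricDensity (α + 1 / 2) w) := by
  have hs : Summable (standardTerm α l q) :=
    (summable_abs_momentTerm hα hl (summable_abs_momentCoeff hα0 hl) q).of_abs.add
      (summable_abs_residueTerm hα0 hα hl.le hq).of_abs
  -- Absolute convergence allows summing over `n₁` first, which produces the truncated moments; the
  -- outer sum over `n₂` is then the exponential expansion.
  have h1 : HasSum (fun n : ℕ × ℕ => standardTerm α l q n.swap) (∑' n, standardTerm α l q n) :=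
    (Equiv.prodComm ℕ ℕ).hasSum_iff.mpr hs.hasSum
  have h2 := h1.prod_fiberwise (g := fun n => 2 * Real.Gamma (α + 1 / 2) *
      (l ^ n * truncMoment (symmetricDensity (α + 1 / 2)) n q)) fun n => by
    have hA := (summable_abs_momentSum_succ hα0 hα n q).of_abs.hasSum.mul_right (l ^ n)
    have hD := (summable_abs_residueSum_succ hα0 hα n hq).of_abs.hasSum.mul_right (l ^ n)
    rw [show 2 * Real.Gamma (α + 1 / 2) *
      (l ^ n * truncMoment (symmetricDensity (α + 1 / 2)) n q) =
      momentSum α (n + 1) q * l ^ n + residueSum α (n + 1) q * l ^ n by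
        rw [← add_mul, ← two_mul_Gamma_mul_truncMoment hα0 hα hq]; ring]
    refine (hA.add hD).congr_fun fun j => ?_
    simp only [standardTerm, Prod.swap]
    rw [show -(j : ℝ) + n = ((n + 1 : ℕ) : ℝ) - 1 - j by push_cast; ring]
  rw [((hasSum_pow_mul_truncMoment (by linarith : 0 < α + 1 / 2) hl q).mul_left _).unique h2]
  exact hs.hasSum

/-! ### The Gamma quotients of the double series -/

theorem Gamma_eq_zero_of_int_nonpos {m : ℤ} (hm : m ≤ 0) : Real.Gamma m = 0 := by
  obtain ⟨n, rfl⟩ := Int.exists_eq_neg_ofNat hm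
  simpa using Real.Gamma_neg_nat_eq_zero n

theorem gammaQuotient_moment {α : ℝ} (hα0 : -(1 / 2) < α) (hα : ∀ m : ℤ, α ≠ m) (j n : ℕ) :
    gammaQuotient (fun β => (-(j : ℝ) + n + 1) / 2 + β) (fun _ => (-(j : ℝ) + n) / 2 + 1) α =
      momentCoeff α (-(j : ℝ) + n) := by
  unfold gammaQuotient momentCoeff
  refine Tendsto.limUnder_eq ?_
  -- The denominator does not depend on `β`: if it is at a pole, the quotient is identically `0`.
  -- Otherwise the numerator has no pole at `α`: for `n - j` odd a pole would make `α` an integer;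
  -- for `n - j` even, `α > -1/2` would put the denominator at a pole too.
  by_cases h0 : Real.Gamma ((-(j : ℝ) + n) / 2 + 1) = 0
  · simp [h0]
  have hne : ∀ m : ℕ, (-(j : ℝ) + n + 1) / 2 + α ≠ -m := by
    intro m hm
    rcases Int.even_or_odd' (-(j : ℤ) + n) with ⟨y, hy | hy⟩
    · have hy' : -(j : ℝ) + n = 2 * y := by exact_mod_cast hy
      have hlt : ((m + y : ℤ) : ℝ) < ((0 : ℤ) : ℝ) := by
        push_cast
        rw [hy'] at hm
        linarith
      have hlt' : (m : ℤ) + y < 0 := by exact_mod_cast hlt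
      refine h0 ?_
      rw [hy', show (2 * (y : ℝ)) / 2 + 1 = ((y + 1 : ℤ) : ℝ) by push_cast; ring]
      exact Gamma_eq_zero_of_int_nonpos (by omega)
    · have hy' : -(j : ℝ) + n = 2 * y + 1 := by exact_mod_cast hy
      refine hα (-m - (y + 1)) ?_
      push_cast
      rw [hy'] at hm
      linarith
  have hc : ContinuousAt (fun β => Real.Gamma ((-(j : ℝ) + n + 1) / 2 + β) /
      Real.Gamma ((-(j : ℝ) + n) / 2 + 1)) α := by
    refine ContinuousAt.div_const ?_ _
    exact ContinuousAt.comp (g := Real.Gamma) (Real.differentiableAt_Gamma hne).continuousAt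
      (by fun_prop)
  exact hc.tendsto.mono_left nhdsWithin_le_nhds

/-- Reflect both Gamma values. The sines are `± 2 sin(πβ) cos(πβ)` and `± cos(πβ)`, so the cosine
cancels: half-integers are removable singularities and the right side is the continuous extension.
-/
theorem Gamma_quotient_eq_of_sin_ne_zero {β : ℝ} (hβ0 : -(1 / 2) < β)
    (hsin : Real.sin (Real.pi * β) ≠ 0) (hcos : Real.cos (Real.pi * β) ≠ 0) (j n : ℕ) :
    Real.Gamma (-2 * (j : ℝ) - n - 1 - 2 * β) / Real.Gamma (-(j : ℝ) + 1 / 2 - β) =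
      (-1) ^ (j + n) / (2 * Real.sin (Real.pi * β)) *
        (Real.Gamma (j + β + 1 / 2) / Real.Gamma (2 * j + n + 2 * β + 2)) := by
  have hj : (0 : ℝ) ≤ j := j.cast_nonneg
  have hn : (0 : ℝ) ≤ n := n.cast_nonneg
  have g1 := Real.Gamma_pos_of_pos (show 0 < (j : ℝ) + β + 1 / 2 by linarith)
  have g2 := Real.Gamma_pos_of_pos (show 0 < 2 * (j : ℝ) + n + 2 * β + 2 by linarith)
  have r1 := Real.Gamma_mul_Gamma_one_sub (-2 * (j : ℝ) - n - 1 - 2 * β)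
  have r2 := Real.Gamma_mul_Gamma_one_sub (-(j : ℝ) + 1 / 2 - β)
  have s1 : Real.sin (Real.pi * (-2 * (j : ℝ) - n - 1 - 2 * β)) =
      (-1) ^ n * (2 * Real.sin (Real.pi * β) * Real.cos (Real.pi * β)) := by
    rw [show Real.pi * (-2 * (j : ℝ) - n - 1 - 2 * β) =
      -(2 * (Real.pi * β) + ((2 * j + n + 1 : ℕ) : ℝ) * Real.pi) by push_cast; ring, Real.sin_neg,
      Real.sin_add_nat_mul_pi, Real.sin_two_mul, pow_succ, pow_add, pow_mul, neg_one_sq, one_pow]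
    ring
  have s2 : Real.sin (Real.pi * (-(j : ℝ) + 1 / 2 - β)) = (-1) ^ j * Real.cos (Real.pi * β) := by
    rw [show Real.pi * (-(j : ℝ) + 1 / 2 - β) = Real.pi / 2 - (Real.pi * β + j * Real.pi) by ring,
      Real.sin_pi_div_two_sub, Real.cos_add_nat_mul_pi]
  rw [s1, show 1 - (-2 * (j : ℝ) - n - 1 - 2 * β) = 2 * j + n + 2 * β + 2 by ring] at r1
  rw [s2, show 1 - (-(j : ℝ) + 1 / 2 - β) = j + β + 1 / 2 by ring] at r2
  have hm : ∀ i : ℕ, (-1 : ℝ) ^ i ≠ 0 := fun i => by positivity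
  have hmm : ∀ i : ℕ, (-1 : ℝ) ^ i * (-1) ^ i = 1 := fun i => by rw [← mul_pow]; norm_num
  have hpi := Real.pi_ne_zero
  rw [← eq_div_iff g2.ne'] at r1
  rw [← eq_div_iff g1.ne'] at r2
  rw [r1, r2, pow_add]
  have hmn := hm n
  have hmj := hm j
  generalize Real.Gamma (j + β + 1 / 2) = G₁ at *
  generalize Real.Gamma (2 * j + n + 2 * β + 2) = G₂ at *
  field_simp
  linear_combination -hmm n

theorem gammaQuotient_residue {α : ℝ} (hα0 : -(1 / 2) < α) (hα : ∀ m : ℤ, α ≠ m) (j n : ℕ) :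
    gammaQuotient (fun β => -2 * (j : ℝ) - n - 1 - 2 * β) (fun β => -(j : ℝ) + 1 / 2 - β) α =
      (-1) ^ (j + n) / (2 * Real.sin (Real.pi * α)) *
        (Real.Gamma (j + α + 1 / 2) / Real.Gamma (2 * j + n + 2 * α + 2)) := by
  have hj : (0 : ℝ) ≤ j := j.cast_nonneg
  have hn : (0 : ℝ) ≤ n := n.cast_nonneg
  have hsin := sin_pi_mul_ne_zero hα
  unfold gammaQuotient
  refine Tendsto.limUnder_eq ?_
  have hpole : ∀ x : ℝ, 0 < x → ∀ m : ℕ, x ≠ -m := fun x hx m h => by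
    have : (0 : ℝ) ≤ m := m.cast_nonneg
    linarith
  have hd1 : 0 < (j : ℝ) + α + 1 / 2 := by linarith
  have hd2 : 0 < 2 * (j : ℝ) + n + 2 * α + 2 := by linarith
  have hc : ContinuousAt (fun β => (-1) ^ (j + n) / (2 * Real.sin (Real.pi * β)) *
      (Real.Gamma (j + β + 1 / 2) / Real.Gamma (2 * j + n + 2 * β + 2))) α := by
    refine ContinuousAt.mul ?_ (ContinuousAt.div ?_ ?_ (Real.Gamma_pos_of_pos hd2).ne')
    · exact ContinuousAt.div (by fun_prop) (by fun_prop) (by simpa using hsin)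
    · exact ContinuousAt.comp (g := Real.Gamma)
        (Real.differentiableAt_Gamma (hpole _ hd1)).continuousAt (by fun_prop)
    · exact ContinuousAt.comp (g := Real.Gamma)
        (Real.differentiableAt_Gamma (hpole _ hd2)).continuousAt (by fun_prop)
  refine (hc.tendsto.mono_left nhdsWithin_le_nhds).congr' ?_
  have e1 : ∀ᶠ β in 𝓝[≠] α, -(1 / 2) < β :=
    (lt_mem_nhds hα0).filter_mono nhdsWithin_le_nhds
  have e2 : ∀ᶠ β in 𝓝[≠] α, Real.sin (Real.pi * β) ≠ 0 :=
    ((show ContinuousAt (fun β => Real.sin (Real.pi * β)) α by fun_prop).eventually_ne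
      hsin).filter_mono nhdsWithin_le_nhds
  have hder : HasDerivAt (fun β => Real.cos (Real.pi * β))
      (-Real.sin (Real.pi * α) * (Real.pi * 1)) α :=
    ((hasDerivAt_id α).const_mul Real.pi).cos
  -- The derivative of the cosine at `α` is nonzero since `sin(πα) ≠ 0`, so even if `α` is a
  -- half-integer the zero is isolated.
  have e3 : ∀ᶠ β in 𝓝[≠] α, Real.cos (Real.pi * β) ≠ 0 :=
    hder.eventually_ne (mul_ne_zero (neg_ne_zero.mpr hsin) (by simp [Real.pi_ne_zero]))
  filter_upwards [e1, e2, e3] with β h1 h2 h3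
  exact (Gamma_quotient_eq_of_sin_ne_zero h1 h2 h3 j n).symm

theorem assetOrNothingTerm_eq_standardTerm {α k s : ℝ} (hα0 : -(1 / 2) < α)
    (hα : ∀ m : ℤ, α ≠ m) (hs : s ≠ 0) (hq : 0 ≤ -k / s) (n : ℕ × ℕ) :
    assetOrNothingTerm α k s n = standardTerm α s (-k / s) n := by
  obtain ⟨j, n⟩ := n
  have hj : (0 : ℝ) ≤ j := j.cast_nonneg
  have hk : -k = s * (-k / s) := by field_simp
  simp only [assetOrNothingTerm, standardTerm]
  rw [gammaQuotient_moment hα0 hα, gammaQuotient_residue hα0 hα]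
  generalize -k / s = q at *
  rw [hk, mul_pow, show 2 * (j : ℝ) + (n + 1 : ℕ) + 2 * α = (2 * (j : ℝ) + 1 + 2 * α) + n by
    push_cast; ring, Real.rpow_add_of_nonneg hq (by linarith) n.cast_nonneg, Real.rpow_natCast,
    residueCoeff, show 2 * (j : ℝ) + (n + 1 : ℕ) + 2 * α + 1 = 2 * j + n + 2 * α + 2 by
    push_cast; ring]
  have hsin := sin_pi_mul_ne_zero hα
  have hfac : (0 : ℝ) < j ! := by positivity
  have g2 := Real.Gamma_pos_of_pos (show 0 < 2 * (j : ℝ) + n + 2 * α + 2 by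
    linarith [show (0 : ℝ) ≤ n from n.cast_nonneg])
  have h1 : (-1 : ℝ) ^ (j + n) * (-1) ^ j = (-1) ^ (n + 1 + 1) := by
    rw [← pow_add, show j + n + j = n + 2 * j by ring, pow_add, pow_mul]
    norm_num [pow_succ]
  rw [← h1]
  generalize Real.Gamma (2 * (j : ℝ) + n + 2 * α + 2) = G at *
  field_simp

/-- The summability and the value of the double series. -/
theorem hasSum_assetOrNothingTerm {α k s : ℝ} (hα0 : -(1 / 2) < α) (hα : ∀ m : ℤ, α ≠ m)
    (hs : s ≠ 0) (hs1 : |s| < 1) (hq : 0 ≤ -k / s) :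
    HasSum (assetOrNothingTerm α k s) (2 * Real.Gamma (α + 1 / 2) *
      ∫ w in Ioi (-k / s), Real.exp (s * (w - -k / s)) * symmetricDensity (α + 1 / 2) w) :=
  (hasSum_standardTerm hα0 hα hs1 hq).congr_fun fun n =>
    assetOrNothingTerm_eq_standardTerm hα0 hα hs hq n

theorem hasSum_assetOrNothingATMTerm {α s : ℝ} (hα0 : -(1 / 2) < α) (hs1 : |s| < 1) :
    HasSum (assetOrNothingATMTerm α s) (2 * Real.Gamma (α + 1 / 2) *
      ∫ w in Ioi (0 : ℝ), Real.exp (s * (w - 0)) * symmetricDensity (α + 1 / 2) w) := by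
  refine ((hasSum_pow_mul_truncMoment (by linarith : 0 < α + 1 / 2) hs1 0).mul_left
    (2 * Real.Gamma (α + 1 / 2))).congr_fun fun n => ?_
  rw [assetOrNothingATMTerm, ← momentCoeff, ← two_mul_Gamma_mul_truncMoment_zero hα0]
  ring

/-! ### The variance gamma law -/

theorem rescaledVol_pos {σ ν : ℝ} (hσ : 0 < σ) (hν : 0 < ν) : 0 < rescaledVol σ ν := by
  unfold rescaledVol
  positivity

theorem rescaledVol_sq {σ ν : ℝ} (hν : 0 < ν) : rescaledVol σ ν ^ 2 = σ ^ 2 * ν / 2 := by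
  rw [rescaledVol, mul_pow, Real.sq_sqrt (by positivity)]
  ring

theorem gaussianPDFReal_mul_gammaPDFReal {σ ν a x z : ℝ} (hσ : 0 < σ) (hν : 0 < ν) (ha : 0 < a)
    (hz : 0 < z) :
    ν * (gaussianPDFReal (0 * (ν * z)) (Real.toNNReal (σ ^ 2 * (ν * z))) x *
      gammaPDFReal a (1 / ν) (ν * z)) =
      1 / (rescaledVol σ ν * (2 * √Real.pi * Real.Gamma a)) *
        (Real.exp (-z) * z ^ (a - 1 / 2 - 1) *
          Real.exp (-((x / rescaledVol σ ν) ^ 2 / 4 / z))) := by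
  have hs := rescaledVol_pos hσ hν
  have hs2 := rescaledVol_sq (σ := σ) hν
  have hG := Real.Gamma_pos_of_pos ha
  have hpi : 0 < √Real.pi := Real.sqrt_pos.mpr Real.pi_pos
  have hv : σ ^ 2 * (ν * z) = 2 * (rescaledVol σ ν ^ 2 * z) := by rw [hs2]; ring
  rw [gaussianPDFReal, gammaPDFReal, if_pos (by positivity), Real.coe_toNNReal _ (by positivity), hv]
  generalize rescaledVol σ ν = s at *
  have h1 : √(2 * Real.pi * (2 * (s ^ 2 * z))) = 2 * √Real.pi * s * √z := by
    rw [show 2 * Real.pi * (2 * (s ^ 2 * z)) = 2 ^ 2 * Real.pi * s ^ 2 * z by ring,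
      Real.sqrt_mul (by positivity), Real.sqrt_mul (by positivity), Real.sqrt_mul (by positivity),
      Real.sqrt_sq (by norm_num), Real.sqrt_sq hs.le]
  have h2 : (ν * z) ^ (a - 1) = ν ^ a / ν * (z ^ (a - 1 / 2 - 1) * √z) := by
    rw [Real.mul_rpow hν.le hz.le, Real.rpow_sub_one hν.ne', Real.sqrt_eq_rpow,
      ← Real.rpow_add hz]
    congr 2
    ring
  have h3 : (1 / ν) ^ a = (ν ^ a)⁻¹ := by rw [one_div, Real.inv_rpow hν.le]
  have h4 : -(x - 0 * (ν * z)) ^ 2 / (2 * (2 * (s ^ 2 * z))) = -((x / s) ^ 2 / 4 / z) := by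
    field_simp
    ring
  have h5 : 1 / ν * (ν * z) = z := by field_simp
  have h6 : 0 < √z := Real.sqrt_pos.mpr hz
  have h7 : 0 < ν ^ a := by positivity
  rw [h1, h2, h3, h4, h5]
  generalize ν ^ a = V at *
  field_simp

theorem vgDensity_eq {σ ν h x : ℝ} (hσ : 0 < σ) (hν : 0 < ν) (hh : 0 < h) (hx : x ≠ 0) :
    vgDensity σ ν 0 h x = ENNReal.ofReal
      (1 / rescaledVol σ ν * symmetricDensity (h / ν) (x / rescaledVol σ ν)) := by
  have ha : 0 < h / ν := by positivity
  have hs := rescaledVol_pos hσ hν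
  set s := rescaledVol σ ν with hsdef
  set G : ℝ → ℝ := fun y => gaussianPDFReal (0 * y) (Real.toNNReal (σ ^ 2 * y)) x *
    gammaPDFReal (h / ν) (1 / ν) y with hG
  have hGscale : ∀ z ∈ Ioi (0 : ℝ), ν * G (ν * z) =
      1 / (s * (2 * √Real.pi * Real.Gamma (h / ν))) * (Real.exp (-z) * z ^ (h / ν - 1 / 2 - 1) *
          Real.exp (-((x / s) ^ 2 / 4 / z))) := fun z hz =>
    gaussianPDFReal_mul_gammaPDFReal hσ hν ha hz
  -- The point `x = 0` is excluded because the mixture integral diverges there when `h/ν ≤ 1/2`; the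
  -- law does not see this null set.
  have hxs : 0 < (x / s) ^ 2 / 4 := by
    have : x / s ≠ 0 := div_ne_zero hx hs.ne'
    positivity
  have hint : IntegrableOn G (Ioi 0) := by
    have h1 : IntegrableOn (fun z => ν * G (ν * z)) (Ioi 0) :=
      IntegrableOn.congr_fun ((integrableOn_besselIntegrand_of_pos (by linarith) hxs).const_mul _)
        (fun z hz => (hGscale z hz).symm) measurableSet_Ioi
    have h2 : IntegrableOn (fun z => G (ν * z)) (Ioi 0) := by
      refine (h1.const_mul ν⁻¹).congr (Eventually.of_forall fun z => ?_)
      simp only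
      field_simp
    simpa using (integrableOn_Ioi_comp_mul_left_iff G 0 hν).mp h2
  have hnn : ∀ y, 0 ≤ G y := fun y =>
    mul_nonneg (gaussianPDFReal_nonneg _ _ _) (gammaPDFReal_nonneg ha (by positivity) y)
  have hval : ∫ y in Ioi (0 : ℝ), G y = 1 / s * symmetricDensity (h / ν) (x / s) := by
    have h1 := integral_comp_mul_left_Ioi' G 0 hν
    rw [mul_zero, smul_eq_mul, ← integral_const_mul,
      setIntegral_congr_fun measurableSet_Ioi hGscale, integral_const_mul] at h1
    rw [← h1, symmetricDensity, besselIntegral]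
    ring
  rw [← hval, ofReal_integral_eq_lintegral_ofReal hint (Eventually.of_forall hnn), vgDensity]
  refine lintegral_congr fun y => ?_
  rw [hG, ENNReal.ofReal_mul (gaussianPDFReal_nonneg _ _ _)]
  rfl

theorem vgMeasure_eq {σ ν h : ℝ} (hσ : 0 < σ) (hν : 0 < ν) (hh : 0 < h) :
    vgMeasure σ ν 0 h = volume.withDensity fun x => ENNReal.ofReal
      (1 / rescaledVol σ ν * symmetricDensity (h / ν) (x / rescaledVol σ ν)) := by
  refine withDensity_congr_ae ?_
  have : ∀ᵐ x : ℝ, x ≠ 0 := by simp [ae_iff]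
  filter_upwards [this] with x hx using vgDensity_eq hσ hν hh hx

theorem measurable_vgReal (s a : ℝ) :
    Measurable fun x => 1 / s * symmetricDensity a (x / s) :=
  ((measurable_symmetricDensity a).comp (measurable_id.div_const s)).const_mul _

theorem integral_vgMeasure {σ ν h : ℝ} (hσ : 0 < σ) (hν : 0 < ν) (hh : 0 < h) (F : ℝ → ℝ) :
    ∫ x, F x ∂vgMeasure σ ν 0 h =
      ∫ v, F (rescaledVol σ ν * v) * symmetricDensity (h / ν) v := by
  have ha : 0 < h / ν := by positivity
  have hs := rescaledVol_pos hσ hν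
  rw [vgMeasure_eq hσ hν hh, integral_withDensity_eq_integral_toReal_smul
    (measurable_vgReal _ _).ennreal_ofReal (Eventually.of_forall fun x => ENNReal.ofReal_lt_top)]
  set s := rescaledVol σ ν
  have h1 := Measure.integral_comp_div (fun v => F (s * v) * symmetricDensity (h / ν) v) s
  rw [abs_of_pos hs, smul_eq_mul] at h1
  rw [eq_comm, ← mul_right_inj' hs.ne', ← h1, ← integral_const_mul]
  refine integral_congr_ae (Eventually.of_forall fun x => ?_)
  have h2 := symmetricDensity_nonneg ha (x / s)
  simp only [smul_eq_mul]
  rw [ENNReal.toReal_ofReal (by positivity), mul_div_cancel₀ _ hs.ne']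
  field_simp

theorem abs_rescaledVol_lt_one {σ ν : ℝ} (hν : 0 < ν) (hσν : σ ^ 2 * ν / 2 < 1) :
    |rescaledVol σ ν| < 1 := by
  rw [← sq_lt_one_iff_abs_lt_one, rescaledVol_sq hν]
  exact hσν

theorem integrable_exp_vgMeasure {σ ν h : ℝ} (hσ : 0 < σ) (hν : 0 < ν) (hσν : σ ^ 2 * ν / 2 < 1)
    (hh : 0 < h) : Integrable Real.exp (vgMeasure σ ν 0 h) := by
  refine Integrable.of_integral_ne_zero ?_
  have hs1 := abs_rescaledVol_lt_one (σ := σ) hν hσν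
  have h2 : 0 < 1 - rescaledVol σ ν ^ 2 := by rw [rescaledVol_sq hν]; linarith
  rw [integral_vgMeasure hσ hν hh,
    (integral_exp_mul_symmetricDensity (by positivity : 0 < h / ν) hs1).2]
  positivity

/-! ### Conditional expectation of a function of a measurable and an independent variable -/

theorem condExp_comp_prodMk_of_indepFun {Ω β : Type*} {mΩ : MeasurableSpace Ω}
    {mβ : MeasurableSpace β} {μ : Measure Ω} [IsProbabilityMeasure μ] {Z : Ω → β} {Y : Ω → ℝ}
    {X : β → ℝ} (hZ : Measurable Z) (hY : Measurable Y) (hX : Measurable X)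
    (hind : IndepFun Z Y μ) {f : ℝ × ℝ → ℝ} (hf : Measurable f)
    (hint : Integrable (fun w => f (X (Z w), Y w)) μ) :
    μ[fun w => f (X (Z w), Y w) | mβ.comap Z] =ᵐ[μ] fun w => ∫ y, f (X (Z w), y) ∂μ.map Y := by
  have : IsProbabilityMeasure (μ.map Y) := Measure.isProbabilityMeasure_map hY.aemeasurable
  -- By independence the conditional law of `Y` given `Z` is the constant kernel.
  have h1 : condDistrib Y Z μ =ᵐ[μ.map Z] Kernel.const β (μ.map Y) := by
    refine condDistrib_ae_eq_of_measure_eq_compProd Z hY.aemeasurable ?_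
    rw [Measure.compProd_const]
    exact (indepFun_iff_map_prod_eq_prod_map_map hZ.aemeasurable hY.aemeasurable).mp hind
  have hf' : StronglyMeasurable fun p : β × ℝ => f (X p.1, p.2) :=
    (hf.comp ((hX.comp measurable_fst).prodMk measurable_snd)).stronglyMeasurable
  filter_upwards [condExp_prod_ae_eq_integral_condDistrib hZ hY.aemeasurable hf' hint,
    ae_of_ae_map hZ.aemeasurable h1] with w hw1 hw2
  rw [hw1, hw2, Kernel.const_apply]

theorem condExp_comp_prodMk_of_indep {Ω : Type*} {m mΩ : MeasurableSpace Ω} (hm : m ≤ mΩ)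
    {μ : Measure Ω} [IsProbabilityMeasure μ] {X Y : Ω → ℝ} (hX : Measurable[m] X)
    (hY : Measurable Y) (hind : Indep m (MeasurableSpace.comap Y inferInstance) μ)
    {f : ℝ × ℝ → ℝ} (hf : Measurable f) (hint : Integrable (fun w => f (X w, Y w)) μ) :
    μ[fun w => f (X w, Y w) | m] =ᵐ[μ] fun w => ∫ y, f (X w, y) ∂μ.map Y := by
  -- The sub-σ-algebra `m` is generated by the identity viewed as a map from `(Ω, mΩ)` to `(Ω, m)`.
  have hind' : @IndepFun Ω Ω ℝ mΩ m _ id Y μ := by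
    refine (IndepFun_iff_Indep (mβ := m) id Y μ).mpr ?_
    rwa [MeasurableSpace.comap_id]
  have h := @condExp_comp_prodMk_of_indepFun Ω Ω mΩ m μ _ id Y X (measurable_id'' hm) hY hX
    hind' f hf hint
  rwa [MeasurableSpace.comap_id] at h

/-! ### The price as an exponential integral of the density -/

theorem stock_eq_forwardStrike_mul_exp {S K r τ σ ν : ℝ} (hS : 0 < S) (hK : 0 < K) :
    S = forwardStrike K r τ *
      Real.exp (moneyness S K r τ σ ν - martingaleAdjustment σ ν * τ) := by
  have hF : 0 < forwardStrike K r τ := by unfold forwardStrike; positivity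
  rw [moneyness, add_sub_cancel_right, Real.exp_log (by positivity)]
  field_simp

theorem discounted_assetOrNothingPayoff {S K r τ σ ν : ℝ} (hS : 0 < S) (hK : 0 < K) (y : ℝ) :
    Real.exp (-r * τ) * assetOrNothingPayoff K
      (S * Real.exp ((r + martingaleAdjustment σ ν) * τ + y)) =
      (Ioi (-moneyness S K r τ σ ν)).indicator (fun y =>
        forwardStrike K r τ * Real.exp (moneyness S K r τ σ ν + y)) y := by
  set k := moneyness S K r τ σ ν with hk
  have h1 : S * Real.exp ((r + martingaleAdjustment σ ν) * τ + y) = K * Real.exp (k + y) := by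
    rw [stock_eq_forwardStrike_mul_exp (r := r) (τ := τ) (σ := σ) (ν := ν) hS hK, ← hk,
      forwardStrike, mul_assoc, mul_assoc, ← Real.exp_add, ← Real.exp_add]
    congr 2
    ring
  rw [h1, assetOrNothingPayoff, indicator_apply]
  have h2 : K < K * Real.exp (k + y) ↔ y ∈ Ioi (-k) := by
    rw [lt_mul_iff_one_lt_right hK, Real.one_lt_exp_iff, mem_Ioi]
    constructor <;> intro h <;> linarith
  simp only [h2, forwardStrike]
  split_ifs
  · ring
  · ring

theorem integral_indicator_mul_symmetricDensity (F k : ℝ) {s : ℝ} (a : ℝ) (hs : 0 < s) :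
    ∫ v, (Ioi (-k)).indicator (fun y => F * Real.exp (k + y)) (s * v) * symmetricDensity a v =
      F * ∫ w in Ioi (-k / s), Real.exp (s * (w - -k / s)) * symmetricDensity a w := by
  rw [← integral_const_mul, ← integral_indicator measurableSet_Ioi]
  congr 1 with v
  have hmem : s * v ∈ Ioi (-k) ↔ v ∈ Ioi (-k / s) := by
    rw [mem_Ioi, mem_Ioi, div_lt_iff₀ hs, mul_comm]
  simp only [indicator_apply, hmem]
  split_ifs
  · rw [show s * (v - -k / s) = k + s * v by field_simp; ring, mul_assoc]
  · simp

/-- Whole line minus complementary half line. The reflection `v ↦ -v` and evenness of the density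
bring the complement to the same shape with `-s` in place of `s`. -/
theorem integral_indicator_mul_symmetricDensity' (F k : ℝ) {s a : ℝ} (ha : 0 < a) (hs : 0 < s)
    (hs1 : |s| < 1) :
    ∫ v, (Ioi (-k)).indicator (fun y => F * Real.exp (k + y)) (s * v) * symmetricDensity a v =
      F * Real.exp k * (1 - s ^ 2) ^ (-a) -
        F * ∫ w in Ioi (-k / -s), Real.exp (-s * (w - -k / -s)) * symmetricDensity a w := by
  obtain ⟨h1, h2⟩ := integral_exp_mul_symmetricDensity ha hs1
  have h3 : ∫ w in Ioi (-k / -s), Real.exp (-s * (w - -k / -s)) * symmetricDensity a w =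
      ∫ v in Iic (-k / s), Real.exp (s * (v - -k / s)) * symmetricDensity a v := by
    have h := integral_comp_neg_Iic (-k / s)
      (fun w => Real.exp (-s * (w - -k / -s)) * symmetricDensity a w)
    rw [show -(-k / s) = -k / -s by rw [div_neg]] at h
    rw [← h]
    refine setIntegral_congr_fun measurableSet_Iic fun v _ => ?_
    simp only [symmetricDensity_neg, div_neg]
    congr 2
    ring
  have h4 : Integrable (fun v => Real.exp (s * (v - -k / s)) * symmetricDensity a v) := by
    refine (h1.const_mul (Real.exp k)).congr (Eventually.of_forall fun v => ?_)
    simp only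
    rw [← mul_assoc, ← Real.exp_add, show s * (v - -k / s) = k + s * v by field_simp; ring]
  have h5 : ∫ v, Real.exp (s * (v - -k / s)) * symmetricDensity a v =
      Real.exp k * (1 - s ^ 2) ^ (-a) := by
    rw [← h2, ← integral_const_mul]
    congr 1 with v
    rw [← mul_assoc, ← Real.exp_add, show s * (v - -k / s) = k + s * v by field_simp; ring]
  have h6 := integral_add_compl (s := Iic (-k / s)) measurableSet_Iic h4
  rw [compl_Iic, h5] at h6
  rw [integral_indicator_mul_symmetricDensity F k a hs, h3]
  linear_combination F * h6

/-- The martingale property of the discounted price: `e^{-ωτ} = (1 - s²)^{-τ/ν}`, so the whole-line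
integral equals the current price. -/
theorem stock_eq_mul_rpow {S K r τ σ ν : ℝ} (hS : 0 < S) (hK : 0 < K) (hν : 0 < ν)
    (hσν : σ ^ 2 * ν / 2 < 1) :
    S = forwardStrike K r τ * Real.exp (moneyness S K r τ σ ν) *
      (1 - rescaledVol σ ν ^ 2) ^ (-(τ / ν)) := by
  have h := stock_eq_forwardStrike_mul_exp (r := r) (τ := τ) (σ := σ) (ν := ν) hS hK
  rw [rescaledVol_sq hν, Real.rpow_def_of_pos (by linarith), mul_assoc, ← Real.exp_add]
  convert h using 3
  rw [martingaleAdjustment]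
  ring

/-! ### The process -/

variable {Ω : Type*} {mΩ : MeasurableSpace Ω} {Q : Measure Ω} {ℱ : Filtration ℝ≥0 mΩ}
  {X : ℝ≥0 → Ω → ℝ} {σ ν : ℝ}

theorem IsVarianceGammaProcess.measurable {θ : ℝ} (hX : IsVarianceGammaProcess Q ℱ X σ ν θ)
    (u : ℝ≥0) : Measurable[ℱ u] (X u) :=
  (hX.adapted u).measurable

theorem IsVarianceGammaProcess.measurable' {θ : ℝ} (hX : IsVarianceGammaProcess Q ℱ X σ ν θ)
    (u : ℝ≥0) : Measurable (X u) :=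
  (hX.measurable u).mono (ℱ.le u) le_rfl

theorem measurable_assetOrNothingPayoff (K : ℝ) : Measurable (assetOrNothingPayoff K) :=
  Measurable.ite measurableSet_Ioi measurable_id measurable_const

theorem integrable_stockPrice (hX : IsVarianceGammaProcess Q ℱ X σ ν 0) (S₀ r : ℝ) (hσ : 0 < σ)
    (hν : 0 < ν) (hσν : σ ^ 2 * ν / 2 < 1) {T : ℝ≥0} (hT : 0 < T) :
    Integrable (stockPrice X S₀ r σ ν T) Q := by
  have hmeas : Measurable fun w => X T w - X 0 w := (hX.measurable' T).sub (hX.measurable' 0)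
  have h1 : Integrable (fun w => Real.exp (X T w - X 0 w)) Q := by
    have h := integrable_exp_vgMeasure hσ hν hσν (h := (T : ℝ) - ((0 : ℝ≥0) : ℝ))
      (by simpa using hT)
    rw [← hX.law 0 T hT] at h
    exact (integrable_map_measure (by fun_prop) hmeas.aemeasurable).mp h
  refine (h1.const_mul (S₀ * Real.exp ((r + martingaleAdjustment σ ν) * T))).congr ?_
  filter_upwards [hX.zero] with w hw
  rw [stockPrice, hw, sub_zero, Real.exp_add, mul_assoc]

theorem integrable_assetOrNothingPayoff (hX : IsVarianceGammaProcess Q ℱ X σ ν 0) (S₀ r K : ℝ)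
    (hσ : 0 < σ) (hν : 0 < ν) (hσν : σ ^ 2 * ν / 2 < 1) {T : ℝ≥0} (hT : 0 < T) :
    Integrable (fun w => assetOrNothingPayoff K (stockPrice X S₀ r σ ν T w)) Q := by
  have h := integrable_stockPrice hX S₀ r hσ hν hσν hT
  refine h.mono ((measurable_assetOrNothingPayoff K).comp_aemeasurable
    h.1.aemeasurable).aestronglyMeasurable (Eventually.of_forall fun w => ?_)
  rw [assetOrNothingPayoff]
  split_ifs <;> simp

/-- The price of the asset-or-nothing call as an integral against the standard density. -/
theorem claimValue_ae_eq [IsProbabilityMeasure Q] (hX : IsVarianceGammaProcess Q ℱ X σ ν 0)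
    {S₀ r K : ℝ} (hS₀ : 0 < S₀) (hK : 0 < K)
    (hσ : 0 < σ) (hν : 0 < ν) (hσν : σ ^ 2 * ν / 2 < 1) {t T : ℝ≥0} (htT : t < T) :
    ∀ᵐ w ∂Q, claimValue Q ℱ X S₀ r σ ν t T (assetOrNothingPayoff K) w =
      ∫ v, (Ioi (-moneyness (stockPrice X S₀ r σ ν t w) K r (T - t) σ ν)).indicator (fun y =>
        forwardStrike K r (T - t) *
          Real.exp (moneyness (stockPrice X S₀ r σ ν t w) K r (T - t) σ ν + y))
        (rescaledVol σ ν * v) * symmetricDensity ((T - t) / ν) v := by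
  have hτ : 0 < (T : ℝ) - t := sub_pos.mpr (by exact_mod_cast htT)
  set f : ℝ × ℝ → ℝ := fun p => Real.exp (-r * ((T : ℝ) - t)) * assetOrNothingPayoff K
    (S₀ * Real.exp ((r + martingaleAdjustment σ ν) * t + p.1) *
      Real.exp ((r + martingaleAdjustment σ ν) * (T - t) + p.2)) with hf
  have hfmeas : Measurable f :=
    ((measurable_assetOrNothingPayoff K).comp (by fun_prop)).const_mul _
  have hfeq : (fun w => Real.exp (-r * ((T : ℝ) - t)) *
      assetOrNothingPayoff K (stockPrice X S₀ r σ ν T w)) =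
      fun w => f (X t w, X T w - X t w) := by
    ext w
    simp only [hf, stockPrice]
    congr 2
    rw [mul_assoc, ← Real.exp_add]
    congr 2
    ring
  have hint : Integrable (fun w => f (X t w, X T w - X t w)) Q := by
    rw [← hfeq]
    exact (integrable_assetOrNothingPayoff hX S₀ r K hσ hν hσν (bot_le.trans_lt htT)).const_mul _
  have hcond := condExp_comp_prodMk_of_indep (Y := fun w => X T w - X t w) (ℱ.le t) (hX.measurable t)
    ((hX.measurable' T).sub (hX.measurable' t)) (hX.indep t T htT.le) hfmeas hint
  rw [← hfeq] at hcond
  filter_upwards [hcond] with w hw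
  rw [claimValue, hw]
  have hlaw : Q.map (fun w => X T w - X t w) = vgMeasure σ ν 0 ((T : ℝ) - t) := hX.law t T htT
  rw [hlaw, integral_vgMeasure hσ hν hτ]
  congr 1 with v
  congr 1
  exact discounted_assetOrNothingPayoff (by positivity) hK _

end VarianceGamma

end

/-! ### The three price formulas -/

theorem mainTheorem2 {Ω : Type*} {mΩ : MeasurableSpace Ω} (Q : Measure Ω) [IsProbabilityMeasure Q]
    (ℱ : Filtration ℝ≥0 mΩ) (X : ℝ≥0 → Ω → ℝ) (S₀ K r σ ν : ℝ) (t T : ℝ≥0)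
    (hS₀ : 0 < S₀) (hK : 0 < K) (hσ : 0 < σ) (hν : 0 < ν) (hσν : σ ^ 2 * ν / 2 < 1)
    (htT : t < T)
    (hα : ∀ m : ℤ, VarianceGamma.alphaParam ((T : ℝ) - (t : ℝ)) ν ≠ (m : ℝ))
    (hX : VarianceGamma.IsVarianceGammaProcess Q ℱ X σ ν 0) :
    Integrable (fun w => VarianceGamma.assetOrNothingPayoff K
      (VarianceGamma.stockPrice X S₀ r σ ν T w)) Q ∧
    ∀ᵐ w ∂Q,
      let τ : ℝ := (T : ℝ) - (t : ℝ)
      let S : ℝ := VarianceGamma.stockPrice X S₀ r σ ν t w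
      let k : ℝ := VarianceGamma.moneyness S K r τ σ ν
      let s : ℝ := VarianceGamma.rescaledVol σ ν
      let α : ℝ := VarianceGamma.alphaParam τ ν
      let C : ℝ := VarianceGamma.claimValue Q ℱ X S₀ r σ ν t T
        (VarianceGamma.assetOrNothingPayoff K) w
      (k < 0 →
        Summable (VarianceGamma.assetOrNothingTerm α k s) ∧
        C = VarianceGamma.assetOrNothingSeries K r τ ν k s) ∧
      (0 < k →
        Summable (VarianceGamma.assetOrNothingTerm α k (-s)) ∧
        C = S - VarianceGamma.assetOrNothingSeries K r τ ν k (-s)) ∧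
      (k = 0 →
        Summable (VarianceGamma.assetOrNothingTerm α k s) ∧
        Summable (VarianceGamma.assetOrNothingTerm α k (-s)) ∧
        Summable (VarianceGamma.assetOrNothingATMTerm α s) ∧
        C = VarianceGamma.assetOrNothingSeries K r τ ν k s ∧
        C = S - VarianceGamma.assetOrNothingSeries K r τ ν k (-s) ∧
        C = VarianceGamma.forwardStrike K r τ / (2 * Real.Gamma (τ / ν)) *
          ∑' n : ℕ, VarianceGamma.assetOrNothingATMTerm α s n) := by
  refine ⟨VarianceGamma.integrable_assetOrNothingPayoff hX S₀ r K hσ hν hσν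
    (bot_le.trans_lt htT), ?_⟩
  filter_upwards [VarianceGamma.claimValue_ae_eq hX (r := r) hS₀ hK hσ hν hσν htT] with w hw
  intro τ S k s α C
  have hτ : 0 < τ := sub_pos.mpr (by exact_mod_cast htT)
  have ha : 0 < τ / ν := by positivity
  have hαa : α + 1 / 2 = τ / ν := sub_add_cancel _ _
  have hα0 : -(1 / 2) < α := by linarith
  have hs : 0 < s := VarianceGamma.rescaledVol_pos hσ hν
  have hs1 : |s| < 1 := VarianceGamma.abs_rescaledVol_lt_one hν hσν
  have hS : 0 < S := by
    simp only [S, VarianceGamma.stockPrice]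
    positivity
  have hG := Real.Gamma_pos_of_pos ha
  set F := VarianceGamma.forwardStrike K r τ with hF
  -- Both integral forms of the price hold for every sign of `k`. The sign only decides which lower
  -- limit, `-k/s` or `k/s`, is nonnegative, as the series requires; at `k = 0` both are.
  have hC1 : C = F * ∫ w in Set.Ioi (-k / s), Real.exp (s * (w - -k / s)) *
      VarianceGamma.symmetricDensity (τ / ν) w :=
    hw.trans (VarianceGamma.integral_indicator_mul_symmetricDensity F k (τ / ν) hs)
  have hC2 : C = S - F * ∫ w in Set.Ioi (-k / -s), Real.exp (-s * (w - -k / -s)) *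
      VarianceGamma.symmetricDensity (τ / ν) w := by
    refine (hw.trans (VarianceGamma.integral_indicator_mul_symmetricDensity' F k ha hs hs1)).trans
      ?_
    congr 1
    exact (VarianceGamma.stock_eq_mul_rpow hS hK hν hσν).symm
  have otm : k ≤ 0 → Summable (VarianceGamma.assetOrNothingTerm α k s) ∧
      C = VarianceGamma.assetOrNothingSeries K r τ ν k s := fun hk => by
    have h := VarianceGamma.hasSum_assetOrNothingTerm hα0 hα hs.ne' hs1
      (div_nonneg (neg_nonneg.mpr hk) hs.le)
    refine ⟨h.summable, ?_⟩
    rw [VarianceGamma.assetOrNothingSeries, h.tsum_eq, hC1, hαa, ← hF]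
    field_simp
  have itm : 0 ≤ k → Summable (VarianceGamma.assetOrNothingTerm α k (-s)) ∧
      C = S - VarianceGamma.assetOrNothingSeries K r τ ν k (-s) := fun hk => by
    have h := VarianceGamma.hasSum_assetOrNothingTerm (k := k) (s := -s) hα0 hα
      (neg_ne_zero.mpr hs.ne') (by rwa [abs_neg])
      (by rw [neg_div_neg_eq]; exact div_nonneg hk hs.le)
    refine ⟨h.summable, ?_⟩
    rw [VarianceGamma.assetOrNothingSeries, h.tsum_eq, hC2, hαa, ← hF]
    field_simp
  refine ⟨fun hk => otm hk.le, fun hk => itm hk.le, fun hk => ?_⟩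
  have h := VarianceGamma.hasSum_assetOrNothingATMTerm hα0 hs1
  refine ⟨(otm hk.le).1, (itm hk.ge).1, h.summable, (otm hk.le).2, (itm hk.ge).2, ?_⟩
  rw [h.tsum_eq, hC1, hαa, hk, neg_zero, zero_div]
  field_simp
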